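/- **Setting.** Let $p\ge 2$ be an integer (not necessarily prime), $\mathbb{Z}_p=\varprojlim \mathbb{Z}/p^n$, $[\mathfrak z]_{p^n}\in\{0,\dots,p^n-1\}$ the residue of $\mathfrak z$ mod $p^n$, and $\theta_p(\mathfrak z)=(\mathfrak z-[\mathfrak z]_p)/p$. Let $\hat{\mathbb{Z}}_p=\mathbb{Z}[1/p]/\mathbb{Z}$. For $t\ne 0$ in $\hat{\mathbb Z}_p$ let $-v_p(t)\geq 1$ be the least $N$ with $p^Nt=0$, and $|t|_p=p^{-v_p(t)}$; put $|0|_p=0$. Let $\#_{p:k}(m)$ be the number of base-$p$ digits of $m$ equal to $k$ (no leading zeros; $0$ has no digits), and let $\mathrm{NiceDig}(\mathbb{Z}_p)$ be the set of $\mathfrak z$ such that $\lim_n \#_{p:k}([\mathfrak z]_{p^n})/n$ exists for all $0\le k<p$. Let $K$ be a global field with ring of integers $\mathcal{O}_K$ (the integral closure of $\mathbb{Z}$, resp. of $\mathbb{F}_\ell[T]$ for a presentation of $K$ as a finite extension of $\mathbb{F}_\ell(T)$), with $\operatorname{char}K$ zero or coprime to $p$. Let $R=\mathcal{O}_K[a_0,\dots,a_{p-1},b_0,\dots,b_{p-1}]$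 be the polynomial ring, $\mathcal{R}=R[x]/\langle(1-a_0)x-1\rangle$, and let $I\subseteq R$ be an ideal with $\langle 1-a_0\rangle\nsubseteq I$ such that $p\neq0$ in $\mathcal{R}/I\mathcal{R}$. A (multiplicative, evaluative) frame $\mathcal{F}$ on $\mathbb{Z}_p$ for a ring $A$ consists of a domain $D(\mathcal F)\subseteq\mathbb{Z}_p$ and an absolute value $|\cdot|_{\mathcal F(\mathfrak z)}$ on $A$ for each $\mathfrak z\in D(\mathcal F)$. It is reffinite if $\mathbb{N}_0\subseteq D(\mathcal F)$, $\theta_p(D(\mathcal F))\subseteq D(\mathcal F)$ and $|\cdot|_{\mathcal F(\theta_p(\mathfrak z))}=|\cdot|_{\mathcal F(\mathfrak z)}$. Also write $\mathcal F(\mathfrak z)$ for the completion of $A$ at $|\cdot|_{\mathcal F(\mathfrak z)}$, and $C(\mathcal F)=\prod_{\mathfrak z\in D(\mathcal F)}\mathcal F(\mathfrak z)$. An $f\in C(\mathcal F)$ is rising-continuous if $f(m)\in A$ for $m\in\mathbb{N}_0$ and $f(\mathfrak z)=\lim_n f([\mathfrak z]_{p^n})$ in $\mathcal F(\mathfrak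 z)$ for all $\mathfrak z\in D(\mathcal F)$. Let $\mathcal{F}$ be a reffinite $\mathcal R$-frame with $D(\mathcal F)\subseteq \mathrm{NiceDig}(\mathbb{Z}_p)$, such that for each $\mathfrak z\in D(\mathcal F)$ the quotient seminorm $q\mapsto\inf\{|r|_{\mathcal F(\mathfrak z)}: r \bmod I\mathcal R=q\}$ is an absolute value on $\mathcal R/I\mathcal R$; these form the quotient frame $\mathcal F/I$, with the same domain. Assume the root-test condition: for every $\mathfrak z\in D(\mathcal F)$, $$\lim_{n\to\infty}\Big|a_0^n\prod_{k=1}^{p-1}(a_k/a_0)^{\#_{p:k}([\mathfrak z]_{p^n})}\Big|^{1/n}_{\mathcal F(\mathfrak z)}\ \text{ exists and is } <1.$$ Let $M=\mathrm{Frac}(\mathcal R/I\mathcal R)$ and $L=M(\zeta_{p^\infty})$, and fix an embedding $t\mapsto e^{2\pi i t}$ of $\hat{\mathbb Z}_p$ in $L^\times$; set $e^{2\pi i\{t\mathfrak z\}_p}=e^{2\pi i t[\mathfrak z]_{|t|_p}}$ for $t\ne0$, and $1$ for $t=0$. A function $\hat f:\hat{\mathbb Z}_p\to L$ is a Fourier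 transform of $f\in C(\mathcal F/I)$ if for every $\mathfrak z\in D(\mathcal F)$ one has $\lim_{N}\sum_{|t|_p\le p^N}\hat f(t)e^{2\pi i\{t\mathfrak z\}_p}=f(\mathfrak z)$ with respect to every absolute value of $L$ extending $|\cdot|_{(\mathcal F/I)(\mathfrak z)}$ (in the completion of $L$); $f$ is quasi-integrable if it has one. Define $\hat X^{*n}:\hat{\mathbb{Z}}_p\to L$ as follows, sums and products being over $0\le j<p$ or the displayed ranges, empty sums being $0$ and empty products $1$. Let $$\alpha_{k,n}(t)=\tfrac1p\sum_j a_j^kb_j^{n-k}e^{-2\pi ijt},\quad \alpha_n(t)=\tfrac1p\sum_j a_j^ne^{-2\pi ijt},\quad \hat A_n(t)=\prod_{m=0}^{-v_p(t)-1}\alpha_n(p^mt).$$ For a function $\beta$ on $\hat{\mathbb Z}_p$ let $\Gamma_{n,\beta}(t)=\beta(p^{-v_p(t)-1}t)\prod_{m=0}^{-v_p(t)-2}\alpha_n(p^mt)$ for $t\ne 0$ (this is $\gamma\big(t|t|_p/p\big)\hat A_n(t)$ with $\gamma=\beta/\alpha_n$, after cancellation), and let $G_{n,\beta}(t)$ be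 $$\begin{cases}0& t=0\\ \beta(0)v_p(t)\hat A_n(t)+\Gamma_{n,\beta}(t)&t\ne0\end{cases}\ \text{ if }\alpha_n(0)=1,\qquad \begin{cases}\frac{\beta(0)}{1-\alpha_n(0)}& t=0\\ \frac{\beta(0)}{1-\alpha_n(0)}\hat A_n(t)+\Gamma_{n,\beta}(t)&t\ne0\end{cases}\ \text{ if }\alpha_n(0)\ne1.$$ Put $\hat X^{*0}=\mathbf 1_0$, $\hat X^{*1}=\hat X=G_{1,\beta_X}$ with $\beta_X(t)=\frac1p\sum_jb_je^{-2\pi ijt}$, and for $n\ge2$, $\hat X^{*n}=\hat f_n-\hat g_n$, where $$\hat f_n(t)=\sum_{k=0}^{n-1}\binom nk\sum_{m=0}^{-v_p(t)-2}\hat X^{*k}(p^{m+1}t)\,\alpha_{k,n}(p^mt)\prod_{h=0}^{m-1}\alpha_n(p^ht)$$ ($\hat f_n(0)=0$), $\hat g_n=G_{n,\beta_n}$, $\beta_n(t)=\frac1p\sum_jc_{n,j}e^{-2\pi ijt}$, and $c_{n,j}=-\sum_{k=0}^{n-1}\binom nka_j^kb_j^{n-k}\hat X^{*k}(0)$. **Theorem.**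 Then: I. There is a unique rising-continuous $X\in C(\mathcal F/I)$ with $X(\mathfrak z)=a_{[\mathfrak z]_p}X(\theta_p(\mathfrak z))+b_{[\mathfrak z]_p}$ in $(\mathcal F/I)(\mathfrak z)$ for all $\mathfrak z\in D(\mathcal F)$. II. For every $n\ge0$, the pointwise power $X^n\in C(\mathcal F/I)$ is $\mathcal F/I$-quasi-integrable. III. For every $n\ge0$, $\hat X^{*n}$ is a Fourier transform of $X^n$ with respect to $\mathcal F/I$. IV. For every $n\ge0$ there is a unique distribution $X^n(\mathfrak z)d\mathfrak z$ in the $M$-linear dual of the space $\mathcal S(\mathbb Z_p,M)$ of locally constant functions $\mathbb{Z}_p\to M$ whose Fourier–Stieltjes transform $t\mapsto\int e^{-2\pi i\{t\mathfrak z\}_p}X^n(\mathfrak z)d\mathfrak z$ is $\hat X^{*n}$. Suppose moreover that $M$ is a $K$-algebra compatibly with $\mathcal O_K\to\mathcal R/I\mathcal R$ (which is possible exactly if $\mathcal O_K\to\mathcal R/I\mathcal R$ is injective), and that at least one of the following holds: (i) $a_0\notin I\mathcal R$ and the restriction of $X$ to $\mathbb N_0$ is not constant (as is the case for $I=0$);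 (ii) $X$ takes infinitely many values on $\mathbb N_0$; (iii) some value $X(m)$, $m\in\mathbb N_0$, is transcendental over $K$. Then the rule $(X^m(\mathfrak z)d\mathfrak z)(X^n(\mathfrak z)d\mathfrak z)=X^{m+n}(\mathfrak z)d\mathfrak z$ extends to a unique bilinear product on the $K$-span of the distributions $X^n(\mathfrak z)d\mathfrak z$, $n\geq 0$; with it, this span is a free $K$-algebra on the generator $X(\mathfrak z)d\mathfrak z$, i.e. isomorphic to the polynomial algebra $K[x]$ by $x^n\mapsto X^n(\mathfrak z)d\mathfrak z$. The Fourier–Stieltjes transform is an isomorphism of $K$-algebras from it onto the $K$-span of the functions $\hat X^{*n}$, $n\ge0$, with the formal convolution product given by $\hat X^{*m}*\hat X^{*n}=\hat X^{*(m+n)}$. -/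

import Mathlib

open Filter Topology Polynomial

noncomputable section

namespace FSeries

/-! ### `p`-adic integers for an arbitrary base `p`, and the dual group `ℤ[1/p]/ℤ` -/

/-- The ring `ℤ_p` (as a set) for an arbitrary integer base `p`, possibly composite: the inverse
limit of the `ℤ/p^n`. An element is given by its residues `[z]_{p^n} ∈ {0, …, p^n - 1}`. -/
@[ext]
structure ZP (p : ℕ) where
  /-- `res n` is the residue `[z]_{p^n}`. -/
  res : ℕ → ℕ
  res_lt : ∀ n, res n < p ^ n
  res_mod : ∀ n, res (n + 1) % p ^ n = res n

namespace ZP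

variable {p : ℕ}

/-- The embedding of the non-negative integers in `ℤ_p`. -/
def ofNat (p : ℕ) [NeZero p] (m : ℕ) : ZP p where
  res n := m % p ^ n
  res_lt n := Nat.mod_lt _ (pow_pos (NeZero.pos p) n)
  res_mod n := Nat.mod_mod_of_dvd m (pow_dvd_pow p n.le_succ)

/-- The shift `θ_p(z) = (z - [z]_p) / p`, which deletes the lowest digit. -/
def shift [NeZero p] (z : ZP p) : ZP p where
  res n := z.res (n + 1) / p
  res_lt n := by
    rw [Nat.div_lt_iff_lt_mul (NeZero.pos p), ← pow_succ]
    exact z.res_lt (n + 1)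
  res_mod n := by
    rw [← z.res_mod (n + 1), pow_succ, Nat.mod_mul_left_div_self]

/-- The lowest digit `[z]_p`. -/
def digit (z : ZP p) : Fin p := ⟨z.res 1, by simpa using z.res_lt 1⟩

end ZP

/-- `#_{p:k}(m)`, the number of digits of `m` in base `p` that are equal to `k` (no leading zeros,
so that the integer `0` has no digits). -/
def digitCount (p k m : ℕ) : ℕ := (Nat.digits p m).count k

/-- The `p`-adic integers all of whose digits `k` have a natural density. -/
def NiceDig (p : ℕ) : Set (ZP p) :=
  {z | ∀ k < p, ∃ δ : ℝ,
    Tendsto (fun n : ℕ => (digitCount p k (z.res n) : ℝ) / (n : ℝ)) atTop (𝓝 δ)}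

/-- `ℤ[1/p]/ℤ`, the Pontryagin dual of `ℤ_p`, realised as the `p`-power torsion of `ℚ/ℤ`. -/
def PHat (p : ℕ) : AddSubgroup (AddCircle (1 : ℚ)) where
  carrier := {t | ∃ N : ℕ, p ^ N • t = 0}
  zero_mem' := ⟨0, by simp⟩
  add_mem' := by
    rintro s t ⟨M, hM⟩ ⟨N, hN⟩
    refine ⟨M + N, ?_⟩
    rw [smul_add, pow_add, mul_smul (p ^ M) (p ^ N) t, hN, mul_comm, mul_smul, hM]
    simp
  neg_mem' := by
    rintro t ⟨N, hN⟩
    exact ⟨N, by rw [smul_neg, hN, neg_zero]⟩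

/-- The element `k / p^N` of `ℤ[1/p]/ℤ`. -/
def frac (p : ℕ) [NeZero p] (N k : ℕ) : PHat p :=
  ⟨(((k : ℚ) / (p : ℚ) ^ N : ℚ) : AddCircle (1 : ℚ)), N, by
    have hp : ((p : ℚ) ^ N) ≠ 0 := pow_ne_zero _ (Nat.cast_ne_zero.mpr (NeZero.ne p))
    rw [← AddCircle.coe_nsmul, AddCircle.coe_eq_zero_iff]
    refine ⟨k, ?_⟩
    simp only [zsmul_eq_mul, nsmul_eq_mul, Nat.cast_pow, mul_one, Int.cast_natCast]
    field_simp⟩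

open Classical in
/-- `-v_p(t)`: the exponent of the denominator of `t`, the least `N` with `p^N t = 0`.
It is `0` exactly for `t = 0`, and `|t|_p = p ^ depth t` for `t ≠ 0`. -/
def depth {p : ℕ} (t : PHat p) : ℕ :=
  Nat.find (p := fun N : ℕ => p ^ N • t = 0)
    (let ⟨N, hN⟩ := t.2; ⟨N, Subtype.ext hN⟩)

/-- `e^{2πi{tz}_p}`, where `e : ℤ[1/p]/ℤ → L` is the chosen embedding `t ↦ e^{2πit}` of the
`p`-power roots of unity. -/
def charEval {p : ℕ} {L : Type*} [Field L] (e : AddChar (PHat p) L) (t : PHat p) (z : ZP p) : L :=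
  e (z.res (depth t) • t)

/-! ### Frames -/

/-- The map between the completions of two rings with absolute values induced by a ring
homomorphism (it is only used for isometric homomorphisms). -/
def complMap {R S : Type*} [CommRing R] [CommRing S]
    (v : AbsoluteValue R ℝ) (w : AbsoluteValue S ℝ) (f : R →+* S) :
    UniformSpace.Completion (WithAbs v) → UniformSpace.Completion (WithAbs w) :=
  UniformSpace.Completion.map (WithAbs.map v w f)

/-- An element of a ring with an absolute value, seen in the completion. -/
def toCompl {R : Type*} [CommRing R] (v : AbsoluteValue R ℝ) (r : R) :
    UniformSpace.Completion (WithAbs v) :=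
  ((WithAbs.toAbs v r : WithAbs v) : UniformSpace.Completion (WithAbs v))

/-- A multiplicative evaluative `R`-frame on `ℤ_p`: a domain `D`, and for each `z ∈ D` an
absolute value on `R` (the seminorm attached to `z` being `f ↦ |f(z)|_{F(z)}`). -/
structure Frame (p : ℕ) (R : Type*) [CommRing R] where
  dom : Set (ZP p)
  abs : dom → AbsoluteValue R ℝ

namespace Frame

variable {p : ℕ} {R : Type*} [CommRing R]

/-- A frame is reffinite if its domain contains `ℕ₀` and is stable under the shift, and if the
absolute values at `z` and at `θ_p(z)` agree. -/
structure Reffinite [NeZero p] (F : Frame p R) : Prop where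
  ofNat_mem : ∀ m : ℕ, ZP.ofNat p m ∈ F.dom
  shift_mem : ∀ z ∈ F.dom, z.shift ∈ F.dom
  abs_shift : ∀ z : F.dom, F.abs ⟨z.1.shift, shift_mem z.1 z.2⟩ = F.abs z

/-- The quotient seminorm `|q| = inf_{r mod I = q} |r|_{F(z)}` on `R / I`. -/
def quotSeminorm (F : Frame p R) (I : Ideal R) (z : F.dom) (q : R ⧸ I) : ℝ :=
  ⨅ r : {r : R // Ideal.Quotient.mk I r = q}, F.abs z r.1

/-- The quotient frame `F / I`, when the quotient seminorms are absolute values. -/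
def quotient (F : Frame p R) (I : Ideal R)
    (h : ∀ z : F.dom, IsAbsoluteValue (F.quotSeminorm I z)) : Frame p (R ⧸ I) where
  dom := F.dom
  abs z := letI := h z; IsAbsoluteValue.toAbsoluteValue (F.quotSeminorm I z)

theorem Reffinite.quotient [NeZero p] {F : Frame p R} (hF : F.Reffinite) (I : Ideal R)
    (h : ∀ z : F.dom, IsAbsoluteValue (F.quotSeminorm I z)) : (F.quotient I h).Reffinite where
  ofNat_mem := hF.ofNat_mem
  shift_mem := hF.shift_mem
  abs_shift z := by
    have key : F.quotSeminorm I ⟨z.1.shift, hF.shift_mem z.1 z.2⟩ = F.quotSeminorm I z := by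
      funext q
      simp only [quotSeminorm, hF.abs_shift z]
    ext q
    exact congrFun key q

/-- `C(F)`, the functions compatible with `F`: the value at `z ∈ D` lies in the completion
`R_{F(z)}` of `R` with respect to the absolute value attached to `z`. -/
abbrev Compat (F : Frame p R) : Type _ :=
  (z : F.dom) → UniformSpace.Completion (WithAbs (F.abs z))

/-- `F`-rising-continuity: `f(z) = lim_n f([z]_{p^n})` in `R_{F(z)}`, for each `z ∈ D`. For the
values `f(m)` with `m ∈ ℕ₀` to make sense in all the completions at once, they lie in `R`. -/
def RisingContinuous [NeZero p] (F : Frame p R) (f : F.Compat) : Prop :=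
  ∃ f₀ : ℕ → R,
    (∀ (m : ℕ) (hm : ZP.ofNat p m ∈ F.dom), f ⟨ZP.ofNat p m, hm⟩ = toCompl _ (f₀ m)) ∧
    ∀ z : F.dom, Tendsto (fun n : ℕ => toCompl (F.abs z) (f₀ (z.1.res n))) atTop (𝓝 (f z))

/-- `X(z) = a_{[z]_p} X(θ_p(z)) + b_{[z]_p}` in `R_{F(z)}` for all `z ∈ D`. -/
def FunctionalEquation [NeZero p] (F : Frame p R) (hF : F.Reffinite) (a b : Fin p → R)
    (X : F.Compat) : Prop :=
  ∀ z : F.dom,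
    X z = toCompl (F.abs z) (a z.1.digit) *
        complMap (F.abs ⟨z.1.shift, hF.shift_mem z.1 z.2⟩) (F.abs z) (RingHom.id R)
          (X ⟨z.1.shift, hF.shift_mem z.1 z.2⟩) +
      toCompl (F.abs z) (b z.1.digit)

/-- `φ : ℤ[1/p]/ℤ → L` is a Fourier transform of `f ∈ C(F)` with respect to `F`:
for every `z ∈ D`, the sums `∑_{|t|_p ≤ p^N} φ(t) e^{2πi{tz}_p}` converge to `f(z)`, for each
absolute value on `L ⊇ R` that extends the one which `F` attaches to `z`. -/
def IsFourierTransform [NeZero p] (F : Frame p R) {L : Type*} [Field L] (ι : R →+* L)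
    (e : AddChar (PHat p) L) (f : F.Compat) (φ : PHat p → L) : Prop :=
  ∀ (z : F.dom) (w : AbsoluteValue L ℝ), (∀ r : R, w (ι r) = F.abs z r) →
    Tendsto
      (fun N : ℕ => toCompl w
        (∑ k ∈ Finset.range (p ^ N), φ (frac p N k) * charEval e (frac p N k) z.1))
      atTop (𝓝 (complMap (F.abs z) w ι (f z)))

/-- `F`-quasi-integrability: the existence of a Fourier transform with respect to `F`. -/
def QuasiIntegrable [NeZero p] (F : Frame p R) {L : Type*} [Field L] (ι : R →+* L)
    (e : AddChar (PHat p) L) (f : F.Compat) : Prop :=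
  ∃ φ : PHat p → L, F.IsFourierTransform ι e f φ

end Frame

/-! ### The universal coefficient ring -/

/-- `O` is the ring of integers of the global field `K`: either `K` is a number field and `O` is
the integral closure of `ℤ`, or `K` is a finite extension of `𝔽_ℓ(T)` for some prime `ℓ` (and some
choice of `T`) and `O` is the integral closure of `𝔽_ℓ[T]`. -/
def IsGlobalFieldIntegers (O K : Type*) [CommRing O] [Field K] [Algebra O K] : Prop :=
  (NumberField K ∧ IsIntegralClosure O ℤ K) ∨
  ∃ (ℓ : ℕ) (_ : Fact ℓ.Prime) (_ : Algebra (RatFunc (ZMod ℓ)) K) (_ : Algebra (ZMod ℓ)[X] K)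
    (_ : IsScalarTower (ZMod ℓ)[X] (RatFunc (ZMod ℓ)) K),
    FunctionField (ZMod ℓ) K ∧ IsIntegralClosure O (ZMod ℓ)[X] K

/-- `R = O[a_0, …, a_{p-1}, b_0, …, b_{p-1}]`. -/
abbrev PolyRing (p : ℕ) (O : Type*) [CommRing O] : Type _ := MvPolynomial (Fin p ⊕ Fin p) O

/-- The indeterminate `a_k` of `R`. -/
def indA {p : ℕ} (O : Type*) [CommRing O] (k : Fin p) : PolyRing p O := MvPolynomial.X (Sum.inl k)

/-- The indeterminate `b_k` of `R`. -/
def indB {p : ℕ} (O : Type*) [CommRing O] (k : Fin p) : PolyRing p O := MvPolynomial.X (Sum.inr k)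

/-- `ℛ = R[x] / ⟨(1 - a_0) x - 1⟩`. -/
abbrev LocRing (p : ℕ) [NeZero p] (O : Type*) [CommRing O] : Type _ :=
  AdjoinRoot (C (1 - indA O (0 : Fin p)) * X - 1 : (PolyRing p O)[X])

/-- The canonical map `R → ℛ`. -/
abbrev toLoc (p : ℕ) [NeZero p] (O : Type*) [CommRing O] : PolyRing p O →+* LocRing p O :=
  AdjoinRoot.of _

/-- `I` is a unique-solution ideal of `R`: `⟨1 - a_0⟩ ⊄ I`. -/
def UniqueSolutionIdeal {p : ℕ} [NeZero p] {O : Type*} [CommRing O]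
    (I : Ideal (PolyRing p O)) : Prop :=
  ¬ Ideal.span {1 - indA O (0 : Fin p)} ≤ I

/-- The ideal `Iℛ` of `ℛ`. -/
abbrev locIdeal {p : ℕ} [NeZero p] {O : Type*} [CommRing O] (I : Ideal (PolyRing p O)) :
    Ideal (LocRing p O) :=
  I.map (toLoc p O)

/-- `ℛ / Iℛ`. -/
abbrev QuotRing {p : ℕ} [NeZero p] {O : Type*} [CommRing O] (I : Ideal (PolyRing p O)) : Type _ :=
  LocRing p O ⧸ locIdeal I

/-- The canonical map `R → ℛ / Iℛ`. -/
def toQuot {p : ℕ} [NeZero p] {O : Type*} [CommRing O] (I : Ideal (PolyRing p O)) :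
    PolyRing p O →+* QuotRing I :=
  (Ideal.Quotient.mk (locIdeal I)).comp (toLoc p O)

/-- The class of `a_k` in `ℛ / Iℛ`. -/
def quotA {p : ℕ} [NeZero p] {O : Type*} [CommRing O] (I : Ideal (PolyRing p O)) (k : Fin p) :
    QuotRing I :=
  toQuot I (indA O k)

/-- The class of `b_k` in `ℛ / Iℛ`. -/
def quotB {p : ℕ} [NeZero p] {O : Type*} [CommRing O] (I : Ideal (PolyRing p O)) (k : Fin p) :
    QuotRing I :=
  toQuot I (indB O k)

/-- The root-test condition: for each `z ∈ D`, the limit of `|a_0^n κ([z]_{p^n})|^{1/n}` exists and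
is less than `1`, where `κ(m) = ∏_{k=1}^{p-1} (a_k / a_0)^{#_{p:k}(m)}`. -/
def RootTest {p : ℕ} [NeZero p] {O : Type*} [CommRing O] (F : Frame p (LocRing p O)) : Prop :=
  ∀ z : F.dom, ∃ ρ : ℝ, ρ < 1 ∧
    Tendsto (fun n : ℕ =>
      (F.abs z (toLoc p O (indA O 0)) ^ n *
        ∏ k ∈ Finset.univ.erase (0 : Fin p),
          (F.abs z (toLoc p O (indA O k)) / F.abs z (toLoc p O (indA O 0))) ^
            digitCount p k (z.1.res n)) ^ (1 / (n : ℝ)))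
      atTop (𝓝 ρ)

/-! ### The Fourier transforms of the powers -/

section Formulas

variable {p : ℕ} {L : Type*} [Field L]

/-- `α_{k,n}(t) = (1/p) ∑_j a_j^k b_j^{n-k} e^{-2πijt}` (for `k ≤ n`). -/
def alphaMix (e : AddChar (PHat p) L) (a b : Fin p → L) (k n : ℕ) (t : PHat p) : L :=
  (p : L)⁻¹ * ∑ j : Fin p, a j ^ k * b j ^ (n - k) * e (-((j : ℕ) • t))

/-- `α_n(t) = (1/p) ∑_j a_j^n e^{-2πijt}`. -/
def alpha (e : AddChar (PHat p) L) (a : Fin p → L) (n : ℕ) (t : PHat p) : L :=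
  (p : L)⁻¹ * ∑ j : Fin p, a j ^ n * e (-((j : ℕ) • t))

/-- `Â(t) = ∏_{m=0}^{-v_p(t)-1} α(p^m t)`. -/
def AHat (α : PHat p → L) (t : PHat p) : L :=
  ∏ m ∈ Finset.range (depth t), α (p ^ m • t)

/-- For `t ≠ 0`, the product `γ(t|t|_p/p) Â(t)`, where `γ = β/α`, with the factor
`α(t|t|_p/p) = α(p^{-v_p(t)-1} t)` of `Â(t)` cancelled against the denominator of `γ`. -/
def gammaAHat (α β : PHat p → L) (t : PHat p) : L :=
  β (p ^ (depth t - 1) • t) * ∏ m ∈ Finset.range (depth t - 1), α (p ^ m • t)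

open Classical in
/-- The function `ĝ` attached to `α` and `β`; recall that `v_p(t) = - depth t`. -/
def gHat (α β : PHat p → L) (t : PHat p) : L :=
  if α 0 = 1 then
    if t = 0 then 0 else -(β 0 * (depth t : L)) * AHat α t + gammaAHat α β t
  else
    if t = 0 then β 0 / (1 - α 0) else β 0 / (1 - α 0) * AHat α t + gammaAHat α β t

/-- `f̂_n(t) = ∑_{k<n} (n choose k) ∑_{m=0}^{-v_p(t)-2} φ_k(p^{m+1}t) α_{k,n}(p^m t)
∏_{h<m} α_n(p^h t)`. -/
def fHat (e : AddChar (PHat p) L) (a b : Fin p → L) (n : ℕ) (φ : Fin n → PHat p → L)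
    (t : PHat p) : L :=
  ∑ k : Fin n, (n.choose k : L) * ∑ m ∈ Finset.range (depth t - 1),
    φ k (p ^ (m + 1) • t) * alphaMix e a b k n (p ^ m • t) *
      ∏ h ∈ Finset.range m, alpha e a n (p ^ h • t)

/-- `c_{n,j} = - ∑_{k<n} (n choose k) a_j^k b_j^{n-k} φ_k(0)`. -/
def cCoeff (a b : Fin p → L) (n : ℕ) (φ : Fin n → PHat p → L) (j : Fin p) : L :=
  -∑ k : Fin n, (n.choose k : L) * a j ^ (k : ℕ) * b j ^ (n - k) * φ k 0

/-- `β_n(t) = (1/p) ∑_j c_{n,j} e^{-2πijt}`. -/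
def beta (e : AddChar (PHat p) L) (a b : Fin p → L) (n : ℕ) (φ : Fin n → PHat p → L)
    (t : PHat p) : L :=
  (p : L)⁻¹ * ∑ j : Fin p, cCoeff a b n φ j * e (-((j : ℕ) • t))

open Classical in
/-- The functions `X̂^{*n}`: the indicator function of `0` for `n = 0`; the function `ĝ` attached to
`α_1` and `(1/p) ∑_j b_j e^{-2πijt}` for `n = 1`; and `f̂_n - ĝ_n` for `n ≥ 2`. -/
def XHat (e : AddChar (PHat p) L) (a b : Fin p → L) : ℕ → PHat p → L
  | 0 => fun t => if t = 0 then 1 else 0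
  | 1 => gHat (alpha e a 1) (alphaMix e a b 0 1)
  | n + 2 => fun t =>
      fHat e a b (n + 2) (fun k => XHat e a b k) t -
        gHat (alpha e a (n + 2)) (beta e a b (n + 2) (fun k => XHat e a b k)) t
  termination_by n => n
  decreasing_by all_goals exact k.2

/-- The restriction to `ℕ₀` of the solution of `X(m) = a_{[m]_p} X(θ_p(m)) + b_{[m]_p}`, that is
`X(0) = b_0/(1-a_0)` and `X(m) = a_{d_0} (a_{d_1} (⋯ X(0) ⋯) + b_{d_1}) + b_{d_0}` for an integer
`m` with base `p` digits `d_0, d_1, …`. -/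
def natValue [NeZero p] (a b : Fin p → L) (m : ℕ) : L :=
  (Nat.digits p m).foldr (fun d x => a (Fin.ofNat p d) * x + b (Fin.ofNat p d))
    (b 0 / (1 - a 0))

end Formulas

/-! ### Distributions -/

/-- `𝒮(ℤ_p, M)`: the locally constant functions `ℤ_p → M`. -/
def SB (p : ℕ) (M : Type*) [Field M] : Submodule M (ZP p → M) where
  carrier := {φ | ∃ N : ℕ, ∀ z w : ZP p, z.res N = w.res N → φ z = φ w}
  zero_mem' := ⟨0, fun _ _ _ => rfl⟩
  add_mem' := by
    rintro φ ψ ⟨m, hm⟩ ⟨n, hn⟩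
    have key : ∀ (z w : ZP p) (k i : ℕ), z.res (i + k) = w.res (i + k) → z.res i = w.res i := by
      intro z w k i h
      induction k with
      | zero => exact h
      | succ k ih => exact ih (by rw [← z.res_mod, ← w.res_mod, add_assoc, h])
    refine ⟨m + n, fun z w h => ?_⟩
    simp only [Pi.add_apply]
    rw [hm z w (key z w n m h), hn z w (key z w m n (by rwa [add_comm n m]))]
  smul_mem' := by
    rintro c φ ⟨N, hN⟩
    exact ⟨N, fun z w h => by simp only [Pi.smul_apply, hN z w h]⟩

open Classical in
/-- The indicator function of `{z : z ≡ k mod p^N}`. -/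
def ballInd (p : ℕ) (M : Type*) [Field M] (N k : ℕ) : SB p M :=
  ⟨fun z => if z.res N = k then 1 else 0, N, fun z w h => by simp only [h]⟩

/-- The space `𝒮(ℤ_p, M)'` of distributions. -/
abbrev Distribution (p : ℕ) (M : Type*) [Field M] : Type _ := Module.Dual M (SB p M)

/-- The Fourier–Stieltjes transform `t ↦ ∫ e^{-2πi{tz}_p} dμ(z)`; the integrand is constant on
the classes modulo `p^{-v_p(t)}`. -/
def fourierStieltjes {p : ℕ} {M L : Type*} [Field M] [Field L] [Algebra M L]
    (e : AddChar (PHat p) L) (μ : Distribution p M) (t : PHat p) : L :=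
  ∑ k ∈ Finset.range (p ^ depth t), e (-(k • t)) * algebraMap M L (μ (ballInd p M (depth t) k))

/-- A bilinear product on the span of a family `v₀, v₁, …` with `v_m v_n = v_{m+n}`. -/
def IsPowerProduct {K V : Type*} [Field K] [AddCommGroup V] [Module K V] (v : ℕ → V)
    (mul : Submodule.span K (Set.range v) →ₗ[K] Submodule.span K (Set.range v) →ₗ[K]
      Submodule.span K (Set.range v)) : Prop :=
  ∀ m n : ℕ, ((mul ⟨v m, Submodule.subset_span ⟨m, rfl⟩⟩ ⟨v n, Submodule.subset_span ⟨n, rfl⟩⟩ :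
    Submodule.span K (Set.range v)) : V) = v (m + n)

/-- The family `v₀, v₁, …` of vectors generates a free `K`-algebra on one generator `v₁` under the
product `v_m v_n = v_{m+n}`: there is a unique bilinear product on the span with this rule, and
`x^n ↦ v_n` is an isomorphism onto it from the polynomial algebra `K[x]`. -/
def GeneratesFreeAlgebra (K : Type*) {V : Type*} [Field K] [AddCommGroup V] [Module K V]
    (v : ℕ → V) : Prop :=
  ∃! mul, IsPowerProduct (K := K) v mul ∧
    ∃ Φ : K[X] ≃ₗ[K] Submodule.span K (Set.range v),
      (∀ n : ℕ, (Φ (X ^ n) : V) = v n) ∧ ∀ f g : K[X], Φ (f * g) = mul (Φ f) (Φ g)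

/-- The linear map `T` induces an isomorphism of algebras from the span of `v₀, v₁, …` with the
product `v_m v_n = v_{m+n}` to the span of `w₀, w₁, …` with the product `w_m w_n = w_{m+n}`. -/
def InducesAlgebraIso (K : Type*) {V W : Type*} [Field K] [AddCommGroup V] [Module K V]
    [AddCommGroup W] [Module K W] (T : V → W) (v : ℕ → V) (w : ℕ → W) : Prop :=
  ∃ mulV mulW, IsPowerProduct (K := K) v mulV ∧ IsPowerProduct (K := K) w mulW ∧
    ∃ Ψ : Submodule.span K (Set.range v) ≃ₗ[K] Submodule.span K (Set.range w),
      (∀ x, (Ψ x : W) = T x) ∧ ∀ x y, Ψ (mulV x y) = mulW (Ψ x) (Ψ y)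

end FSeries

end

/-! Let P_N = ∏_{i<N} a_{d_i} and Q_N = ∑_{i<N} b_{d_i} ∏_{j<i} a_{d_j}, over the first N digits d_i
of z (`digitProd`, `digitSum`). The root test makes |P_N| decay geometrically (`RootTest.hasDecay`),
so Q_N converges, and its limit is X. At integers X is also the finite value obtained from the fixed
point of x ↦ a_0 x + b_0, which exists because 1 - a_0 is a unit.

The X̂^{*n} are built so that X̂^{*n}(t) = ∑_{k≤n} (n choose k) α_{k,n}(t) X̂^{*k}(pt) + c_n Â_n(t)
(`XHat_eq`). This is the Fourier side of expanding (a X∘θ_p + b)^n. The defect c_n vanishes unless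
α_n(0) = 1; in that case X̂^{*n}(0) drops out of the equation at t = 0, and c_n absorbs what the
terms k < n leave over. On Fourier sums, composing with t ↦ pt and multiplying by the transform of a
function of the lowest digit peels off that digit (`fourierSum_mul_comp`). Hence the Fourier sum of
level N is (P_N x + Q_N)^n + ∑_{i<N} (P_N x + Q_i)^n, where x^k is read as u_k = X̂^{*k}(0) in the
first power and as c_k in the others (`fourierSum_XHat`). As N grows, P_N kills all terms with k ≥
1, even against the N defect terms; since u_0 = 1 and c_0 = 0, what remains is Q_N^n, which tends to
X^n (`tendsto_momentSum_sub`).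

The u_k and c_k lie in M, so the Fourier sums do too; divided by p^N they are compatible weights on
the classes modulo p^N, that is, a distribution (`exists_fourierStieltjes_eq`). Fourier inversion
identifies its transform and gives uniqueness. A relation ∑ f_n X^n(z)dz = 0, tested on shrinking
balls about an integer m and multiplied by p^N, becomes f(X(m)) = 0 in the limit
(`aeval_eq_zero_of_sum_eq_zero`). Each of the three assumptions then forces f = 0. For the first,
X(p^k m) - X(0) = a_0^k (X(m) - X(0)) with 0 < |a_0| < 1 gives infinitely many values
(`infinite_range_solValue`). So the distributions are linearly independent, their span inherits the
product of K[x], and the injective transform carries it over. -/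

noncomputable section

namespace FSeries

/-! ### Denominator exponents in ℤ[1/p]/ℤ. -/

section Depth

variable {p : ℕ}

theorem pow_depth_smul (t : PHat p) : p ^ depth t • t = 0 := by
  classical
  exact Nat.find_spec (p := fun N : ℕ => p ^ N • t = 0) _

theorem pow_smul_eq_zero_of_le {t : PHat p} {M N : ℕ} (h : M ≤ N) (ht : p ^ M • t = 0) :
    p ^ N • t = 0 := by
  obtain ⟨k, rfl⟩ := Nat.exists_eq_add_of_le h
  rw [pow_add, mul_comm, mul_smul, ht, smul_zero]

theorem depth_le_iff {t : PHat p} {N : ℕ} : depth t ≤ N ↔ p ^ N • t = 0 := by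
  classical
  refine ⟨fun h => pow_smul_eq_zero_of_le h (pow_depth_smul t), fun h => ?_⟩
  exact Nat.find_min' (p := fun N : ℕ => p ^ N • t = 0) _ h

theorem depth_eq_zero_iff {t : PHat p} : depth t = 0 ↔ t = 0 := by
  rw [← Nat.le_zero, depth_le_iff, pow_zero, one_smul]

@[simp]
theorem depth_zero : depth (0 : PHat p) = 0 := depth_eq_zero_iff.mpr rfl

end Depth

/-! ### Fractions k/p^N as elements of the dual group. -/

section Dual

variable {p : ℕ} [NeZero p]

theorem frac_add (N k l : ℕ) : frac p N (k + l) = frac p N k + frac p N l := by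
  apply Subtype.ext
  simp only [frac, AddSubgroup.coe_add, Nat.cast_add, add_div, AddCircle.coe_add]

theorem smul_frac (m N k : ℕ) : m • frac p N k = frac p N (m * k) := by
  apply Subtype.ext
  rw [AddSubgroup.coe_nsmul]
  simp only [frac]
  rw [← AddCircle.coe_nsmul]
  simp only [nsmul_eq_mul, Nat.cast_mul, mul_div_assoc]

theorem frac_add_mul (N M k : ℕ) : frac p (N + M) (p ^ M * k) = frac p N k := by
  apply Subtype.ext
  have hp : (p : ℚ) ≠ 0 := Nat.cast_ne_zero.mpr (NeZero.ne p)
  simp only [frac, Nat.cast_mul, Nat.cast_pow]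
  congr 1
  rw [pow_add, mul_comm, mul_div_mul_right _ _ (pow_ne_zero _ hp)]

theorem p_smul_frac (N k : ℕ) : p • frac p (N + 1) k = frac p N k := by
  rw [smul_frac]
  simpa using frac_add_mul (p := p) N 1 k

theorem frac_eq_zero_iff (N k : ℕ) : frac p N k = 0 ↔ p ^ N ∣ k := by
  have hp : ((p : ℚ) ^ N) ≠ 0 := pow_ne_zero _ (Nat.cast_ne_zero.mpr (NeZero.ne p))
  rw [← Subtype.coe_inj]
  simp only [frac, AddSubgroup.coe_zero]
  rw [AddCircle.coe_eq_zero_iff]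
  constructor
  · rintro ⟨n, hn⟩
    rw [zsmul_eq_mul, mul_one, eq_div_iff hp] at hn
    rw [← Int.natCast_dvd_natCast]
    exact ⟨n, by rw [mul_comm]; exact_mod_cast hn.symm⟩
  · rintro ⟨c, rfl⟩
    exact ⟨c, by simp [mul_comm ((p : ℚ) ^ N), hp]⟩

@[simp]
theorem frac_zero (N : ℕ) : frac p N 0 = 0 := by simp [frac_eq_zero_iff]

theorem frac_mod (N k : ℕ) : frac p N (k % p ^ N) = frac p N k := by
  conv_rhs => rw [← Nat.mod_add_div k (p ^ N), frac_add]
  rw [(frac_eq_zero_iff N _).mpr (dvd_mul_right _ _), add_zero]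

theorem pow_smul_frac (N k : ℕ) : p ^ N • frac p N k = 0 := by
  rw [smul_frac, frac_eq_zero_iff]
  exact dvd_mul_right _ _

/-- A rational lift q of t has p^N q equal to an integer n, and reducing n modulo p^N changes q by
an integer. -/
theorem exists_frac {N : ℕ} {t : PHat p} (h : p ^ N • t = 0) : ∃ k < p ^ N, t = frac p N k := by
  have hp : 0 < p ^ N := pow_pos (NeZero.pos p) N
  have hp' : ((p : ℚ) ^ N) ≠ 0 := pow_ne_zero _ (Nat.cast_ne_zero.mpr (NeZero.ne p))
  obtain ⟨t, ht⟩ := t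
  obtain ⟨q, rfl⟩ := QuotientAddGroup.mk_surjective t
  have h1 : ((p ^ N • q : ℚ) : AddCircle (1 : ℚ)) = 0 := by
    rw [AddCircle.coe_nsmul]; exact congrArg Subtype.val h
  rw [AddCircle.coe_eq_zero_iff] at h1
  obtain ⟨n, hn⟩ := h1
  rw [zsmul_eq_mul, mul_one, nsmul_eq_mul, Nat.cast_pow] at hn
  have hpz : (0 : ℤ) < (p : ℤ) ^ N := by exact_mod_cast hp
  have h0 := Int.emod_nonneg n hpz.ne'
  have h2 := Int.emod_lt_of_pos n hpz
  refine ⟨(n % (p : ℤ) ^ N).toNat, by zify; rw [Int.toNat_of_nonneg h0]; exact h2, ?_⟩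
  apply Subtype.ext
  simp only [frac]
  have h3 : (((n % (p : ℤ) ^ N).toNat : ℕ) : ℚ) = ((n % (p : ℤ) ^ N : ℤ) : ℚ) := by
    exact_mod_cast congrArg (Int.cast : ℤ → ℚ) (Int.toNat_of_nonneg h0)
  have h4 : q = ((n % (p : ℤ) ^ N : ℤ) : ℚ) / (p : ℚ) ^ N + (n / (p : ℤ) ^ N) • (1 : ℚ) := by
    have h5 : (n : ℚ) = ((n % (p : ℤ) ^ N : ℤ) : ℚ) + (p : ℚ) ^ N * ((n / (p : ℤ) ^ N : ℤ) : ℚ) := by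
      exact_mod_cast (Int.emod_add_mul_ediv n ((p : ℤ) ^ N)).symm
    rw [zsmul_eq_mul, mul_one]
    field_simp
    rw [← h5, hn, mul_comm]
  rw [h3]
  conv_lhs => rw [h4]
  change ((_ + _ : ℚ) : AddCircle (1 : ℚ)) = _
  rw [AddCircle.coe_add, AddCircle.coe_zsmul, AddCircle.coe_period, smul_zero, add_zero]

omit [NeZero p] in
theorem depth_p_smul (t : PHat p) : depth (p • t) = depth t - 1 := by
  apply le_antisymm
  · rw [depth_le_iff, ← mul_smul, ← pow_succ]
    exact depth_le_iff.mp (by omega)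
  · rw [tsub_le_iff_right, depth_le_iff, pow_succ, mul_smul]
    exact pow_depth_smul _

theorem depth_frac_le (N k : ℕ) : depth (frac p N k) ≤ N := depth_le_iff.mpr (pow_smul_frac N k)

theorem exists_eq_frac_depth (t : PHat p) : ∃ k < p ^ depth t, t = frac p (depth t) k :=
  exists_frac (pow_depth_smul t)

end Dual

/-- Used in two ways: with n = p^N the variable s is the top digit of the index, with n = p the
variable r is its lowest digit. -/
theorem sum_range_mul_eq {A : Type*} [AddCommMonoid A] (f : ℕ → A) (n m : ℕ) :
    ∑ k ∈ Finset.range (n * m), f k =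
      ∑ r ∈ Finset.range n, ∑ s ∈ Finset.range m, f (r + n * s) := by
  rw [Finset.sum_comm]
  induction m with
  | zero => simp
  | succ m ih =>
    rw [mul_add, mul_one, Finset.sum_range_add, ih, Finset.sum_range_succ]
    simp only [add_comm]

theorem char_smul_mod {p : ℕ} {L : Type*} [Field L] (e : AddChar (PHat p) L) (N m : ℕ)
    {t : PHat p} (ht : p ^ N • t = 0) : e ((m % p ^ N) • t) = e (m • t) := by
  conv_rhs => rw [← Nat.mod_add_div m (p ^ N), add_smul, mul_comm, mul_smul, ht, smul_zero,
    add_zero]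

/-! ### Orthogonality of characters and Fourier sums of finite level. -/

section Characters

variable {p : ℕ} [NeZero p] {L : Type*} [Field L] {e : AddChar (PHat p) L}

/-- A geometric sum in a p^N-th root of unity, which differs from 1 for u ≠ v because e is
injective. -/
theorem sum_char_frac (he : Function.Injective e) {N u v : ℕ} (hu : u < p ^ N) (hv : v < p ^ N) :
    ∑ k ∈ Finset.range (p ^ N), e (k • frac p N u) * e (-(k • frac p N v)) =
      if u = v then (p : L) ^ N else 0 := by
  set x := e (frac p N u - frac p N v) with hx
  have h1 : ∀ k : ℕ, e (k • frac p N u) * e (-(k • frac p N v)) = x ^ k := by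
    intro k
    rw [← AddChar.map_add_eq_mul, ← AddChar.map_nsmul_eq_pow, smul_sub, sub_eq_add_neg]
  simp only [h1]
  split_ifs with h
  · have : x = 1 := by rw [hx, h, sub_self, AddChar.map_zero_eq_one]
    simp [this]
  · have hx1 : x ≠ 1 := by
      rw [hx, ← AddChar.map_zero_eq_one e, he.ne_iff, sub_ne_zero]
      wlog huv : u < v generalizing u v
      · exact (this hv hu rfl (fun k => by
          rw [← AddChar.map_add_eq_mul, ← AddChar.map_nsmul_eq_pow, smul_sub, sub_eq_add_neg])
          (Ne.symm h) (by omega)).symm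
      intro h2
      have h3 : frac p N (v - u) = 0 := by
        have : frac p N v = frac p N u + frac p N (v - u) := by
          rw [← frac_add]; congr 1; omega
        rw [← h2] at this
        simpa using this
      rw [frac_eq_zero_iff] at h3
      have := Nat.le_of_dvd (by omega) h3
      omega
    have hxp : x ^ p ^ N = 1 := by
      rw [hx, ← AddChar.map_nsmul_eq_pow, smul_sub, pow_smul_frac, pow_smul_frac, sub_self,
        AddChar.map_zero_eq_one]
    have := geom_sum_mul x (p ^ N)
    rw [hxp, sub_self] at this
    exact (mul_eq_zero.mp this).resolve_right (sub_ne_zero.mpr hx1)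

variable (e)

/-- The sum `∑_{|t|_p ≤ p^N} φ(t) e^{2πitm}`. -/
def fourierSum (φ : PHat p → L) (N m : ℕ) : L :=
  ∑ k ∈ Finset.range (p ^ N), φ (frac p N k) * e (m • frac p N k)

theorem fourierSum_zero_level (φ : PHat p → L) (m : ℕ) : fourierSum e φ 0 m = φ 0 := by
  simp [fourierSum]

variable {e}

theorem frac_add_pow_mul (N r s : ℕ) :
    frac p (N + 1) (r + p ^ N * s) = frac p (N + 1) r + frac p 1 s := by
  rw [frac_add, add_comm N 1, frac_add_mul]

/-- The sums over the classes of digits. -/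
theorem sum_fourierSum (he : Function.Injective e) (φ : PHat p → L) (N m : ℕ) :
    ∑ j ∈ Finset.range p, fourierSum e φ (N + 1) (m + p ^ N * j) = p * fourierSum e φ N m := by
  -- The top digit j enters only through the character at p^N t = u/p, so summing over j kills every
  -- frequency whose numerator is not divisible by p. The others have level N.
  have h1 : ∀ u : ℕ, ∑ j ∈ Finset.range p, e ((m + p ^ N * j) • frac p (N + 1) u) =
      e (m • frac p (N + 1) u) * if u % p = 0 then (p : L) else 0 := by
    intro u
    have h2 := sum_char_frac he (N := 1) (u := u % p) (v := 0)
      (by simpa using Nat.mod_lt u (NeZero.pos p)) (by simpa using NeZero.pos p)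
    rw [pow_one, pow_one] at h2
    rw [← h2, Finset.mul_sum]
    refine Finset.sum_congr rfl fun j _ => ?_
    have h3 : frac p 1 (u % p) = p ^ N • frac p (N + 1) u := by
      have := frac_mod (p := p) 1 u
      rw [pow_one] at this
      rw [this, smul_frac, add_comm N 1, frac_add_mul]
    rw [frac_zero, smul_zero, neg_zero, AddChar.map_zero_eq_one, mul_one, h3, add_smul,
      AddChar.map_add_eq_mul, mul_comm (p ^ N), mul_smul]
  simp only [fourierSum]
  rw [Finset.sum_comm]
  simp only [← Finset.mul_sum, h1]
  rw [pow_succ', sum_range_mul_eq, Finset.sum_eq_single_of_mem 0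
    (Finset.mem_range.mpr (NeZero.pos p)), Finset.mul_sum]
  · refine Finset.sum_congr rfl fun s _ => ?_
    have h4 : frac p (N + 1) (p * s) = frac p N s := by
      simpa using frac_add_mul (p := p) N 1 s
    simp only [zero_add, Nat.mul_mod_right, if_true, h4]
    ring
  · intro r hr hr0
    refine Finset.sum_eq_zero fun s _ => ?_
    rw [Nat.add_mul_mod_self_left, Nat.mod_eq_of_lt (Finset.mem_range.mp hr), if_neg hr0]
    simp

/-- Fourier inversion. -/
theorem sum_neg_fourierSum (he : Function.Injective e) (φ : PHat p → L) {N v : ℕ}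
    (hv : v < p ^ N) :
    ∑ k ∈ Finset.range (p ^ N), e (-(k • frac p N v)) * fourierSum e φ N k =
      (p : L) ^ N * φ (frac p N v) := by
  simp only [fourierSum, Finset.mul_sum]
  rw [Finset.sum_comm]
  have : ∀ u ∈ Finset.range (p ^ N), ∑ k ∈ Finset.range (p ^ N),
      e (-(k • frac p N v)) * (φ (frac p N u) * e (k • frac p N u)) =
      if u = v then (p : L) ^ N * φ (frac p N v) else 0 := by
    intro u hu
    have h := sum_char_frac he (Finset.mem_range.mp hu) hv
    calc _ = φ (frac p N u) * ∑ k ∈ Finset.range (p ^ N),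
          e (k • frac p N u) * e (-(k • frac p N v)) := by
          rw [Finset.mul_sum]; exact Finset.sum_congr rfl fun k _ => by ring
      _ = _ := by rw [h]; split_ifs with h' <;> simp [h', mul_comm]
  rw [Finset.sum_congr rfl this]
  simp [hv]

/-- The Fourier sums of `α φ(p·)`, where `α` is the transform of a function of the last digit. -/
theorem fourierSum_mul_comp (he : Function.Injective e) (hp : (p : L) ≠ 0) (g : Fin p → L)
    (φ : PHat p → L) (N m : ℕ) :
    fourierSum e (fun t => ((p : L)⁻¹ * ∑ j : Fin p, g j * e (-((j : ℕ) • t))) * φ (p • t))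
      (N + 1) m = g (Fin.ofNat p m) * fourierSum e φ N (m / p) := by
  have hm : m % p < p ^ 1 := by simpa using Nat.mod_lt m (NeZero.pos p)
  -- The lowest digit of m pairs with t, the remaining digits with pt.
  have h1 : ∀ (t : PHat p), e (m • t) = e ((m % p) • t) * e ((m / p) • p • t) := by
    intro t
    rw [← AddChar.map_add_eq_mul, ← mul_smul, ← add_smul, mul_comm, Nat.mod_add_div]
  -- The frequencies (r + p^N s)/p^(N+1) with r fixed share the same multiple pt. Summing over s is
  -- orthogonality on ℤ/p and selects j = m mod p.
  have key : ∀ r : ℕ, ∑ s ∈ Finset.range p,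
      (∑ j : Fin p, g j * e (-((j : ℕ) • frac p (N + 1) (r + p ^ N * s)))) *
        e ((m % p) • frac p (N + 1) (r + p ^ N * s)) = p * g (Fin.ofNat p m) := by
    intro r
    have h2 : ∀ s : ℕ, (∑ j : Fin p, g j * e (-((j : ℕ) • frac p (N + 1) (r + p ^ N * s)))) *
        e ((m % p) • frac p (N + 1) (r + p ^ N * s)) =
        ∑ j : Fin p, g j * e (-((j : ℕ) • frac p (N + 1) r)) * e ((m % p) • frac p (N + 1) r) *
          (e (s • frac p 1 (m % p)) * e (-(s • frac p 1 j))) := by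
      intro s
      rw [Finset.sum_mul]
      refine Finset.sum_congr rfl fun j _ => ?_
      have h3 : ∀ i : ℕ, i • frac p 1 s = s • frac p 1 i := fun i => by
        rw [smul_frac, smul_frac, mul_comm]
      rw [frac_add_pow_mul, smul_add, smul_add, neg_add, AddChar.map_add_eq_mul,
        AddChar.map_add_eq_mul, h3, h3]
      ring
    rw [Finset.sum_congr rfl fun s _ => h2 s, Finset.sum_comm]
    have h4 : ∀ j : Fin p, ∑ s ∈ Finset.range p,
        g j * e (-((j : ℕ) • frac p (N + 1) r)) * e ((m % p) • frac p (N + 1) r) *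
          (e (s • frac p 1 (m % p)) * e (-(s • frac p 1 j))) =
        if Fin.ofNat p m = j then p * g j else 0 := by
      intro j
      have h5 := sum_char_frac he hm (v := (j : ℕ)) (by simp)
      rw [pow_one] at h5
      rw [← Finset.mul_sum, h5]
      have h6 : m % p = (j : ℕ) ↔ Fin.ofNat p m = j := by
        rw [Fin.ext_iff]; rfl
      simp only [h6]
      split_ifs with h
      · rw [h6.mpr h, mul_assoc (g j), ← AddChar.map_add_eq_mul]
        simp [mul_comm]
      · simp
    rw [Finset.sum_congr rfl fun j _ => h4 j]
    simp
  rw [fourierSum, pow_succ, sum_range_mul_eq, fourierSum, Finset.mul_sum]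
  refine Finset.sum_congr rfl fun r _ => ?_
  have h7 : ∀ s : ℕ, p • frac p (N + 1) (r + p ^ N * s) = frac p N r := by
    intro s
    rw [p_smul_frac, frac_add, (frac_eq_zero_iff N _).mpr (dvd_mul_right _ _), add_zero]
  calc _ = ∑ s ∈ Finset.range p, (p : L)⁻¹ * (φ (frac p N r) * e ((m / p) • frac p N r)) *
        ((∑ j : Fin p, g j * e (-((j : ℕ) • frac p (N + 1) (r + p ^ N * s)))) *
        e ((m % p) • frac p (N + 1) (r + p ^ N * s))) := by
        refine Finset.sum_congr rfl fun s _ => ?_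
        rw [h1, h7]
        ring
    _ = _ := by
        rw [← Finset.mul_sum, key]
        field_simp

end Characters

/-! ### Umbral calculus of affine maps and the closed form of the Fourier sums. -/

section Umbral

variable {A : Type*} [CommRing A]

/-- The result of replacing each `x^k` by `u k` in the polynomial `(P x + Q)^n`. -/
def umbralPow (P Q : A) (u : ℕ → A) (n : ℕ) : A :=
  ∑ k ∈ Finset.range (n + 1), (n.choose k : A) * P ^ k * Q ^ (n - k) * u k

/-- Umbral substitution is the linear functional x^k ↦ u_k on polynomials, so identities between
powers of affine polynomials transfer to it. -/
theorem exists_umbral (u : ℕ → A) :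
    ∃ Λ : A[X] →ₗ[A] A, ∀ P Q n, Λ ((C P * X + C Q) ^ n) = umbralPow P Q u n := by
  refine ⟨Polynomial.lsum fun k => LinearMap.toSpanSingleton A A (u k), fun P Q n => ?_⟩
  rw [add_pow, map_sum, umbralPow]
  refine Finset.sum_congr rfl fun k _ => ?_
  have : (C P * X) ^ k * C Q ^ (n - k) * ((n.choose k : ℕ) : A[X]) =
      C ((n.choose k : A) * P ^ k * Q ^ (n - k)) * X ^ k := by
    simp only [map_mul, map_pow, map_natCast]
    ring
  rw [this, C_mul_X_pow_eq_monomial]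
  simp [Polynomial.lsum_apply, Polynomial.sum_monomial_index]

/-- Apply the functional to the binomial expansion of (a(Px + Q) + b)^n: a further digit composes
affine maps. -/
theorem sum_umbralPow (a b P Q : A) (u : ℕ → A) (n : ℕ) :
    ∑ k ∈ Finset.range (n + 1), (n.choose k : A) * a ^ k * b ^ (n - k) * umbralPow P Q u k =
      umbralPow (a * P) (a * Q + b) u n := by
  obtain ⟨Λ, hΛ⟩ := exists_umbral u
  simp only [← hΛ]
  have : (C (a * P) * X + C (a * Q + b)) ^ n = ∑ k ∈ Finset.range (n + 1),
      ((n.choose k : A) * a ^ k * b ^ (n - k)) • (C P * X + C Q) ^ k := by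
    have h : C (a * P) * X + C (a * Q + b) = C a * (C P * X + C Q) + C b := by
      simp only [map_mul, map_add]; ring
    rw [h, add_pow]
    refine Finset.sum_congr rfl fun k _ => ?_
    rw [smul_eq_C_mul, mul_pow]
    simp only [map_mul, map_pow, map_natCast]
    ring
  rw [this, map_sum]
  simp only [map_smul, smul_eq_mul]

theorem umbralPow_zero_right (P : A) (u : ℕ → A) (n : ℕ) : umbralPow P 0 u n = P ^ n * u n := by
  rw [umbralPow, Finset.sum_eq_single_of_mem n (by simp)]
  · simp
  · intro k hk hkn
    have : n - k ≠ 0 := by have := Finset.mem_range.mp hk; omega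
    simp [zero_pow this]

theorem map_umbralPow {B : Type*} [CommRing B] (f : A →+* B) (P Q : A) (u : ℕ → A) (n : ℕ) :
    f (umbralPow P Q u n) = umbralPow (f P) (f Q) (fun k => f (u k)) n := by
  simp [umbralPow]

variable {p : ℕ} [NeZero p]

/-- The product `∏_{i<N} a_{d_i}` over the first `N` digits of `m`. -/
def digitProd (a : Fin p → A) : ℕ → ℕ → A
  | 0, _ => 1
  | N + 1, m => a (Fin.ofNat p m) * digitProd a N (m / p)

/-- The sum `∑_{i<N} b_{d_i} ∏_{j<i} a_{d_j}` over the first `N` digits of `m`. -/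
def digitSum (a b : Fin p → A) : ℕ → ℕ → A
  | 0, _ => 0
  | N + 1, m => a (Fin.ofNat p m) * digitSum a b N (m / p) + b (Fin.ofNat p m)

theorem map_digitProd {B : Type*} [CommRing B] (f : A →+* B) (a : Fin p → A) (N m : ℕ) :
    f (digitProd a N m) = digitProd (fun k => f (a k)) N m := by
  induction N generalizing m with
  | zero => simp [digitProd]
  | succ N ih => simp [digitProd, ih]

theorem map_digitSum {B : Type*} [CommRing B] (f : A →+* B) (a b : Fin p → A) (N m : ℕ) :
    f (digitSum a b N m) = digitSum (fun k => f (a k)) (fun k => f (b k)) N m := by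
  induction N generalizing m with
  | zero => simp [digitSum]
  | succ N ih => simp [digitSum, ih]

/-- The closed form of the Fourier sums of level `N` at `m`, where `u` is the sequence of values
of the transforms at `0`, and `c` the sequence of defects of their functional equations. -/
def momentSum (a b : Fin p → A) (u c : ℕ → A) (n N m : ℕ) : A :=
  umbralPow (digitProd a N m) (digitSum a b N m) u n +
    ∑ i ∈ Finset.range N, umbralPow (digitProd a N m) (digitSum a b i m) c n

theorem map_momentSum {B : Type*} [CommRing B] (f : A →+* B) (a b : Fin p → A) (u c : ℕ → A)
    (n N m : ℕ) : f (momentSum a b u c n N m) =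
      momentSum (fun k => f (a k)) (fun k => f (b k)) (fun k => f (u k)) (fun k => f (c k))
        n N m := by
  simp [momentSum, map_umbralPow, map_digitProd, map_digitSum]

theorem momentSum_zero (a b : Fin p → A) (u c : ℕ → A) (n m : ℕ) :
    momentSum a b u c n 0 m = u n := by
  simp [momentSum, digitProd, digitSum, umbralPow_zero_right]

/-- The new digit turns the i-th defect term into the (i+1)-st. The vacated term i = 0 is c_n P^n,
because the empty digit sum is 0. -/
theorem momentSum_succ (a b : Fin p → A) (u c : ℕ → A) (n N m : ℕ) :
    momentSum a b u c n (N + 1) m =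
      ∑ k ∈ Finset.range (n + 1), (n.choose k : A) * a (Fin.ofNat p m) ^ k *
        b (Fin.ofNat p m) ^ (n - k) * momentSum a b u c k N (m / p) +
      c n * digitProd a (N + 1) m ^ n := by
  simp only [momentSum, mul_add, Finset.sum_add_distrib, sum_umbralPow]
  simp only [Finset.mul_sum]
  rw [Finset.sum_comm]
  simp only [sum_umbralPow]
  rw [Finset.sum_range_succ']
  simp only [digitProd, digitSum, umbralPow_zero_right]
  ring

end Umbral

/-! ### Functional equations of ĝ, f̂ and X̂^{*n} under t ↦ pt. -/

section Recursion

variable {p : ℕ} {L : Type*} [Field L] {e : AddChar (PHat p) L}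

theorem depth_eq_succ {t : PHat p} (ht : t ≠ 0) : depth t = depth (p • t) + 1 := by
  have := mt depth_eq_zero_iff.mp ht
  rw [depth_p_smul]
  omega

theorem pow_smul_p_smul (m : ℕ) (t : PHat p) : p ^ m • p • t = p ^ (m + 1) • t := by
  rw [← mul_smul, pow_succ]

theorem AHat_eq (α : PHat p → L) {t : PHat p} (ht : t ≠ 0) :
    AHat α t = α t * AHat α (p • t) := by
  rw [AHat, depth_eq_succ ht, Finset.prod_range_succ', AHat, mul_comm]
  simp [pow_smul_p_smul]

theorem AHat_zero (α : PHat p → L) : AHat α (0 : PHat p) = 1 := by simp [AHat]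

theorem gammaAHat_eq (α β : PHat p → L) {t : PHat p} (ht : p • t ≠ 0) :
    gammaAHat α β t = α t * gammaAHat α β (p • t) := by
  have ht0 : t ≠ 0 := by rintro rfl; simp at ht
  rw [gammaAHat, gammaAHat, depth_eq_succ ht0, depth_eq_succ ht]
  simp only [Nat.add_sub_cancel, pow_smul_p_smul]
  rw [Finset.prod_range_succ']
  simp only [pow_zero, one_smul]
  ring

theorem gammaAHat_of_smul_eq_zero (α β : PHat p → L) {t : PHat p} (ht0 : t ≠ 0)
    (ht : p • t = 0) : gammaAHat α β t = β t := by
  rw [gammaAHat, depth_eq_succ ht0, ht]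
  simp

open Classical in
-- The failure of ĝ(t) = α(t) ĝ(pt) has two sources: β enters once, on the p-torsion, and for α(0) =
-- 1 the factor v_p(t) drops by one at each step.
theorem gHat_eq (α β : PHat p → L) (t : PHat p) :
    gHat α β t = α t * gHat α β (p • t) + (if p • t = 0 then β t else 0) -
      (if α 0 = 1 then β 0 else 0) * AHat α t := by
  by_cases h1 : α 0 = 1
  · by_cases ht : t = 0
    · subst ht; simp [gHat, h1, AHat_zero]
    · by_cases hpt : p • t = 0
      · simp only [gHat, h1, ht, hpt, if_true, if_false, gammaAHat_of_smul_eq_zero α β ht hpt,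
          depth_eq_succ ht, depth_zero]
        push_cast
        ring
      · simp only [gHat, h1, ht, hpt, if_true, if_false, gammaAHat_eq α β hpt,
          depth_eq_succ ht, AHat_eq α ht]
        push_cast
        ring
  · have h2 : 1 - α 0 ≠ 0 := sub_ne_zero.mpr (Ne.symm h1)
    by_cases ht : t = 0
    · subst ht
      simp only [gHat, h1, if_true, if_false, smul_zero]
      field_simp
      ring
    · by_cases hpt : p • t = 0
      · simp only [gHat, h1, ht, hpt, if_true, if_false, gammaAHat_of_smul_eq_zero α β ht hpt,
          AHat_eq α ht, AHat_zero]
        ring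
      · simp only [gHat, h1, ht, hpt, if_false, gammaAHat_eq α β hpt, AHat_eq α ht]
        ring

theorem fHat_of_smul_eq_zero (a b : Fin p → L) (n : ℕ) (φ : Fin n → PHat p → L) {t : PHat p}
    (ht : p • t = 0) : fHat e a b n φ t = 0 := by
  rw [fHat, ← depth_p_smul, ht]
  simp

theorem fHat_eq (a b : Fin p → L) (n : ℕ) (φ : Fin n → PHat p → L) {t : PHat p}
    (ht : p • t ≠ 0) : fHat e a b n φ t =
      ∑ k : Fin n, (n.choose k : L) * alphaMix e a b k n t * φ k (p • t) +
        alpha e a n t * fHat e a b n φ (p • t) := by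
  rw [fHat, fHat, ← depth_p_smul, depth_eq_succ ht, Nat.add_sub_cancel, Finset.mul_sum,
    ← Finset.sum_add_distrib]
  refine Finset.sum_congr rfl fun k _ => ?_
  rw [Finset.sum_range_succ', mul_add, add_comm]
  congr 1
  · simp
    ring
  · simp only [Finset.mul_sum, pow_smul_p_smul]
    refine Finset.sum_congr rfl fun m _ => ?_
    rw [Finset.prod_range_succ']
    simp only [pow_zero, one_smul]
    ring

theorem alphaMix_self (a b : Fin p → L) (n : ℕ) (t : PHat p) :
    alphaMix e a b n n t = alpha e a n t := by
  simp [alphaMix, alpha]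

theorem beta_eq (a b : Fin p → L) (n : ℕ) (φ : Fin n → PHat p → L) (t : PHat p) :
    beta e a b n φ t =
      -∑ k : Fin n, (n.choose k : L) * alphaMix e a b k n t * φ k 0 := by
  simp only [beta, cCoeff, alphaMix, Finset.mul_sum, neg_mul, Finset.sum_mul, mul_neg,
    Finset.sum_neg_distrib]
  rw [Finset.sum_comm]
  congr 1
  refine Finset.sum_congr rfl fun k _ => Finset.sum_congr rfl fun j _ => by ring

variable (e) in
open Classical in
/-- The defect of the functional equation of `XHat n`. -/
def defect (a b : Fin p → L) (n : ℕ) : L :=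
  if alpha e a n 0 = 1 then
    -∑ k ∈ Finset.range n, (n.choose k : L) * alphaMix e a b k n 0 * XHat e a b k 0
  else 0

/-- For n = 0 the functional equation compares indicators of 0 at t and at pt; on the p-torsion this
is orthogonality. -/
theorem alpha_zero_exp [NeZero p] (he : Function.Injective e) (hp : (p : L) ≠ 0) (a : Fin p → L)
    {t : PHat p} (ht : p • t = 0) : alpha e a 0 t = if t = 0 then 1 else 0 := by
  obtain ⟨v, hv, rfl⟩ := exists_frac (N := 1) (t := t) (by simpa using ht)
  have h := sum_char_frac he (N := 1) (u := 0) (v := v) (by simpa using NeZero.pos p) hv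
  simp only [alpha, pow_zero, one_mul]
  rw [pow_one] at h hv
  rw [Fin.sum_univ_eq_sum_range (fun j : ℕ => e (-(j • frac p 1 v)))]
  simp only [frac_zero, smul_zero, AddChar.map_zero_eq_one, one_mul] at h
  rw [h]
  have h2 : frac p 1 v = 0 ↔ 0 = v := by
    rw [frac_eq_zero_iff, pow_one]
    exact ⟨fun h => (Nat.eq_zero_of_dvd_of_lt h hv).symm, fun h => h ▸ dvd_zero _⟩
  simp only [h2]
  split_ifs <;> simp [hp]

open Classical in
/-- The functional equation of the transforms `XHat n`. -/
theorem XHat_eq [NeZero p] (he : Function.Injective e) (hp : (p : L) ≠ 0) (a b : Fin p → L) (n : ℕ)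
    (t : PHat p) : XHat e a b n t =
      ∑ k ∈ Finset.range (n + 1), (n.choose k : L) * alphaMix e a b k n t *
        XHat e a b k (p • t) + defect e a b n * AHat (alpha e a n) t := by
  rw [Finset.sum_range_succ, alphaMix_self, Nat.choose_self, Nat.cast_one, one_mul]
  match n with
  | 0 =>
    have h0 : XHat e a b 0 = fun t => if t = 0 then 1 else 0 := by rw [XHat]
    simp only [h0, defect, Finset.range_zero, Finset.sum_empty, neg_zero, ite_self, zero_mul,
      add_zero, zero_add]
    by_cases ht : p • t = 0
    · rw [if_pos ht, mul_one, alpha_zero_exp he hp a ht]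
    · have : t ≠ 0 := by rintro rfl; simp at ht
      simp [ht, this]
  | 1 =>
    have h0 : XHat e a b 0 = fun t => if t = 0 then 1 else 0 := by rw [XHat]
    have h1 : XHat e a b 1 = gHat (alpha e a 1) (alphaMix e a b 0 1) := by rw [XHat]
    rw [h1, gHat_eq]
    simp only [defect, Finset.sum_range_one, h0, Nat.choose_zero_right, Nat.cast_one, one_mul,
      if_true, mul_one, mul_ite, mul_zero]
    split_ifs <;> ring
  | n + 2 =>
    have h2 : XHat e a b (n + 2) = fun t =>
      fHat e a b (n + 2) (fun k => XHat e a b k) t -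
        gHat (alpha e a (n + 2)) (beta e a b (n + 2) (fun k => XHat e a b k)) t := by
      rw [XHat]
    have h3 : ∀ s, ∑ k ∈ Finset.range (n + 2), ((n + 2).choose k : L) *
        alphaMix e a b k (n + 2) t * XHat e a b k s = ∑ k : Fin (n + 2),
        ((n + 2).choose k : L) * alphaMix e a b k (n + 2) t * XHat e a b k s := fun s =>
      (Fin.sum_univ_eq_sum_range (fun k : ℕ => ((n + 2).choose k : L) *
        alphaMix e a b k (n + 2) t * XHat e a b k s) (n + 2)).symm
    have h4 : defect e a b (n + 2) = if alpha e a (n + 2) 0 = 1 then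
        beta e a b (n + 2) (fun k => XHat e a b k) 0 else 0 := by
      rw [defect, beta_eq, Fin.sum_univ_eq_sum_range (fun k : ℕ => ((n + 2).choose k : L) *
        alphaMix e a b k (n + 2) 0 * XHat e a b k 0) (n + 2)]
    rw [h2, h3, h4]
    beta_reduce
    rw [gHat_eq]
    -- On the p-torsion f̂ vanishes and -β_n(t) supplies the terms k < n; elsewhere those terms come
    -- from the summand m = 0 of f̂.
    by_cases ht : p • t = 0
    · rw [fHat_of_smul_eq_zero a b _ _ ht, ht,
        fHat_of_smul_eq_zero a b _ _ (smul_zero p), if_pos rfl, beta_eq _ _ _ _ t]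
      ring
    · rw [fHat_eq a b _ _ ht, if_neg ht]
      ring

end Recursion

/-! ### The Fourier sums of X̂^{*n} and their field of values. -/

section ClosedForm

variable {p : ℕ} [NeZero p] {L : Type*} [Field L] {e : AddChar (PHat p) L}

/-- When α_n(0) = 1, the relation Â(t) = α_n(t) Â(pt) holds at t = 0 too, so every digit contributes
its factor a_d^n. -/
theorem fourierSum_AHat (he : Function.Injective e) (hp : (p : L) ≠ 0) (a : Fin p → L) {n : ℕ}
    (h : alpha e a n 0 = 1) (N m : ℕ) :
    fourierSum e (AHat (alpha e a n)) N m = digitProd a N m ^ n := by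
  induction N generalizing m with
  | zero => simp [fourierSum_zero_level, AHat_zero, digitProd]
  | succ N ih =>
    have h1 : AHat (alpha e a n) = fun t => alpha e a n t * AHat (alpha e a n) (p • t) := by
      funext t
      by_cases ht : t = 0
      · subst ht; simp [AHat_zero, h]
      · exact AHat_eq _ ht
    rw [h1, digitProd, mul_pow, ← ih]
    exact fourierSum_mul_comp he hp (fun j => a j ^ n) _ N m

theorem fourierSum_add (φ ψ : PHat p → L) (N m : ℕ) :
    fourierSum e (fun t => φ t + ψ t) N m = fourierSum e φ N m + fourierSum e ψ N m := by
  simp only [fourierSum, add_mul, Finset.sum_add_distrib]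

theorem fourierSum_mul_left (c : L) (φ : PHat p → L) (N m : ℕ) :
    fourierSum e (fun t => c * φ t) N m = c * fourierSum e φ N m := by
  simp only [fourierSum, Finset.mul_sum, mul_assoc]

theorem fourierSum_sum {ι : Type*} (s : Finset ι) (φ : ι → PHat p → L) (N m : ℕ) :
    fourierSum e (fun t => ∑ i ∈ s, φ i t) N m = ∑ i ∈ s, fourierSum e (φ i) N m := by
  simp only [fourierSum, Finset.sum_mul]
  exact Finset.sum_comm

/-- The Fourier sums of `XHat n`. -/
theorem fourierSum_XHat (he : Function.Injective e) (hp : (p : L) ≠ 0) (a b : Fin p → L)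
    (n N m : ℕ) : fourierSum e (XHat e a b n) N m =
      momentSum a b (fun k => XHat e a b k 0) (defect e a b) n N m := by
  induction N generalizing n m with
  | zero => rw [fourierSum_zero_level, momentSum_zero]
  | succ N ih =>
    rw [momentSum_succ, funext (XHat_eq he hp a b n), fourierSum_add, fourierSum_sum,
      fourierSum_mul_left]
    congr 1
    · refine Finset.sum_congr rfl fun k _ => ?_
      rw [← ih]
      simp only [mul_assoc]
      rw [fourierSum_mul_left, ← mul_assoc (_ ^ _)]
      congr 1
      exact fourierSum_mul_comp he hp (fun j => a j ^ k * b j ^ (n - k)) _ N m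
    · by_cases h : alpha e a n 0 = 1
      · rw [fourierSum_AHat he hp a h]
      · simp [defect, h]

omit [NeZero p] in
theorem defect_zero (a b : Fin p → L) : defect e a b 0 = 0 := by simp [defect]

omit [NeZero p] in
theorem XHat_zero_zero (a b : Fin p → L) : XHat e a b 0 0 = 1 := by simp [XHat]

omit [NeZero p] in
/-- The values at `0` of the transforms lie in the field of the coefficients. -/
theorem XHat_zero_mem {a b : Fin p → L} {E : Subfield L} (ha : ∀ k, a k ∈ E)
    (hb : ∀ k, b k ∈ E) (n : ℕ) : XHat e a b n 0 ∈ E ∧ defect e a b n ∈ E := by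
  -- At t = 0 all character values are 1, so no roots of unity enter.
  have h1 : ∀ k n, alphaMix e a b k n 0 ∈ E := fun k n => by
    refine E.mul_mem (E.inv_mem (natCast_mem E p)) (E.sum_mem fun j _ => ?_)
    simpa using E.mul_mem (E.pow_mem (ha j) k) (E.pow_mem (hb j) (n - k))
  have h2 : ∀ n, alpha e a n 0 ∈ E := fun n => by
    rw [← alphaMix_self a b]; exact h1 n n
  induction n using Nat.strong_induction_on with
  | _ n ih =>
    have h3 : ∑ k ∈ Finset.range n, (n.choose k : L) * alphaMix e a b k n 0 * XHat e a b k 0 ∈ E :=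
      E.sum_mem fun k hk => E.mul_mem (E.mul_mem (natCast_mem E _) (h1 k n))
        (ih k (Finset.mem_range.mp hk)).1
    refine ⟨?_, ?_⟩
    · have h4 : ∀ β : PHat p → L, β 0 ∈ E → gHat (alpha e a n) β 0 ∈ E := by
        intro β hβ
        simp only [gHat, if_true]
        split_ifs
        · exact E.zero_mem
        · exact E.div_mem hβ (E.sub_mem E.one_mem (h2 n))
      match n with
      | 0 => rw [XHat_zero_zero]; exact E.one_mem
      | 1 => rw [XHat]; exact h4 _ (h1 0 1)
      | n + 2 =>
        rw [XHat]
        beta_reduce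
        rw [fHat_of_smul_eq_zero a b _ _ (smul_zero p)]
        refine E.sub_mem E.zero_mem (h4 _ ?_)
        rw [beta_eq, Fin.sum_univ_eq_sum_range (fun k : ℕ => ((n + 2).choose k : L) *
          alphaMix e a b k (n + 2) 0 * XHat e a b k 0) (n + 2)]
        exact E.neg_mem h3
    · rw [defect]
      split_ifs
      · exact E.neg_mem h3
      · exact E.zero_mem

end ClosedForm

/-! ### Locally constant functions and distributions as compatible weights. -/

section LocallyConstant

variable {p : ℕ}

theorem ZP.res_mod_of_le (z : ZP p) {M N : ℕ} (h : M ≤ N) : z.res N % p ^ M = z.res M := by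
  induction N, h using Nat.le_induction with
  | base => exact Nat.mod_eq_of_lt (z.res_lt M)
  | succ N h ih => rw [← ih, ← z.res_mod N, Nat.mod_mod_of_dvd _ (pow_dvd_pow p h)]

variable {M : Type*} [Field M]

/-- `f` is constant on the classes modulo `p^N`. -/
def HasLevel (f : SB p M) (N : ℕ) : Prop :=
  ∀ z w : ZP p, z.res N = w.res N → f.1 z = f.1 w

theorem HasLevel.mono {f : SB p M} {m n : ℕ} (hf : HasLevel f m) (h : m ≤ n) : HasLevel f n :=
  fun z w hzw => hf z w (by rw [← z.res_mod_of_le h, ← w.res_mod_of_le h, hzw])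

theorem exists_hasLevel (f : SB p M) : ∃ N, HasLevel f N := f.2

variable [NeZero p]

theorem HasLevel.eq_sum {f : SB p M} {N : ℕ} (hf : HasLevel f N) :
    f = ∑ k ∈ Finset.range (p ^ N), f.1 (ZP.ofNat p k) • ballInd p M N k := by
  apply Subtype.ext
  funext z
  rw [AddSubmonoidClass.coe_finsetSum, Finset.sum_apply,
    Finset.sum_eq_single_of_mem (z.res N) (Finset.mem_range.mpr (z.res_lt N))]
  · simp only [ballInd, SetLike.val_smul, Pi.smul_apply, if_true, smul_eq_mul, mul_one]
    exact hf _ _ (Nat.mod_eq_of_lt (z.res_lt N)).symm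
  · intro k _ hk
    simp [ballInd, Ne.symm hk]

theorem Distribution.ext_ballInd {μ ν : Distribution p M}
    (h : ∀ N, ∀ k < p ^ N, μ (ballInd p M N k) = ν (ballInd p M N k)) : μ = ν := by
  refine LinearMap.ext fun f => ?_
  obtain ⟨N, hN⟩ := exists_hasLevel f
  rw [hN.eq_sum, map_sum, map_sum]
  refine Finset.sum_congr rfl fun k hk => ?_
  rw [map_smul, map_smul, h N k (Finset.mem_range.mp hk)]

omit [NeZero p] in
theorem hasLevel_ballInd (N k : ℕ) : HasLevel (ballInd p M N k) N :=
  fun z w h => by simp only [ballInd, h]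

theorem ballInd_ofNat {N j k : ℕ} (hj : j < p ^ N) :
    (ballInd p M N k).1 (ZP.ofNat p j) = if j = k then 1 else 0 := by
  simp only [ballInd, ZP.ofNat, Nat.mod_eq_of_lt hj]

theorem ballInd_eq_sum {N k : ℕ} (hk : k < p ^ N) :
    ballInd p M N k = ∑ j ∈ Finset.range p, ballInd p M (N + 1) (k + p ^ N * j) := by
  have hp := NeZero.pos p
  rw [((hasLevel_ballInd N k).mono N.le_succ).eq_sum, pow_succ, sum_range_mul_eq]
  have h : ∀ r ∈ Finset.range (p ^ N), ∀ s, (ballInd p M N k).1 (ZP.ofNat p (r + p ^ N * s)) =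
      if r = k then 1 else 0 := by
    intro r hr s
    rw [← ballInd_ofNat (Finset.mem_range.mp hr)]
    exact hasLevel_ballInd N k _ _ (by simp [ZP.ofNat])
  rw [Finset.sum_eq_single_of_mem k (Finset.mem_range.mpr hk)]
  · refine Finset.sum_congr rfl fun s _ => ?_
    rw [h k (Finset.mem_range.mpr hk), if_pos rfl, one_smul]
  · intro r hr hrk
    refine Finset.sum_eq_zero fun s _ => ?_
    rw [h r hr, if_neg hrk, zero_smul]

/-- A compatible family of weights of the classes modulo the powers of `p` defines a
distribution. -/
theorem exists_distribution (w : ℕ → ℕ → M)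
    (hw : ∀ N, ∀ k < p ^ N, ∑ j ∈ Finset.range p, w (N + 1) (k + p ^ N * j) = w N k) :
    ∃ μ : Distribution p M, ∀ N, ∀ k < p ^ N, μ (ballInd p M N k) = w N k := by
  -- Weighted sums over the classes of level N. By compatibility they are the same at every level at
  -- which f is constant on classes, so the arbitrary choice of `lev` below does not matter.
  let S : ℕ → SB p M → M := fun N f =>
    ∑ k ∈ Finset.range (p ^ N), f.1 (ZP.ofNat p k) * w N k
  have hS1 : ∀ {f : SB p M} {N : ℕ}, HasLevel f N → S (N + 1) f = S N f := by
    intro f N hf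
    simp only [S]
    rw [pow_succ, sum_range_mul_eq]
    refine Finset.sum_congr rfl fun r hr => ?_
    rw [← hw N r (Finset.mem_range.mp hr), Finset.mul_sum]
    refine Finset.sum_congr rfl fun s _ => ?_
    rw [hf (ZP.ofNat p (r + p ^ N * s)) (ZP.ofNat p r) (by simp [ZP.ofNat])]
  have hS2 : ∀ {f : SB p M} {m n : ℕ}, HasLevel f m → m ≤ n → S n f = S m f := by
    intro f m n hf h
    induction n, h using Nat.le_induction with
    | base => rfl
    | succ n h ih => rw [hS1 (hf.mono h), ih]
  choose lev hlev using exists_hasLevel (p := p) (M := M)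
  have hS3 : ∀ {f : SB p M} {n : ℕ}, HasLevel f n → S (lev f) f = S n f := fun {f n} hf => by
    rw [← hS2 (hlev f) (le_max_left _ n), hS2 hf (le_max_right _ n)]
  refine ⟨⟨⟨fun f => S (lev f) f, fun f g => ?_⟩, fun c f => ?_⟩, fun N k hk => ?_⟩
  · rw [← hS2 (hlev f) (le_max_left _ (lev g)), ← hS2 (hlev g) (le_max_right (lev f) _)]
    rw [hS3 (n := max (lev f) (lev g))]
    · simp only [S, ← Finset.sum_add_distrib]
      refine Finset.sum_congr rfl fun k _ => ?_
      rw [← add_mul]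
      rfl
    · intro z w h
      have h1 := (hlev f).mono (le_max_left _ (lev g)) z w h
      have h2 := (hlev g).mono (le_max_right (lev f) _) z w h
      change f.1 z + g.1 z = f.1 w + g.1 w
      rw [h1, h2]
  · change S (lev (c • f)) (c • f) = c * S (lev f) f
    rw [hS3 (n := lev f)]
    · simp only [S, Finset.mul_sum]
      refine Finset.sum_congr rfl fun k _ => ?_
      rw [← mul_assoc]
      rfl
    · intro z w h
      change c * f.1 z = c * f.1 w
      rw [hlev f z w h]
  · change S (lev (ballInd p M N k)) (ballInd p M N k) = w N k
    rw [hS3 (hasLevel_ballInd N k)]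
    simp only [S]
    rw [Finset.sum_eq_single_of_mem k (Finset.mem_range.mpr hk)]
    · rw [ballInd_ofNat hk, if_pos rfl, one_mul]
    · intro j hj hjk
      rw [ballInd_ofNat (Finset.mem_range.mp hj), if_neg hjk, zero_mul]

end LocallyConstant

/-! ### The Fourier–Stieltjes transform and its inversion. -/

section Transform

variable {p : ℕ} [NeZero p] {M L : Type*} [Field M] [Field L] [Algebra M L]
  {e : AddChar (PHat p) L}

/-- Each class splits into p subclasses of the next level, on which the character of t takes the
same value. -/
theorem fourierStieltjes_eq (μ : Distribution p M) {N : ℕ} {t : PHat p} (h : depth t ≤ N) :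
    fourierStieltjes e μ t = ∑ k ∈ Finset.range (p ^ N),
      e (-(k • t)) * algebraMap M L (μ (ballInd p M N k)) := by
  induction N, h using Nat.le_induction with
  | base => rfl
  | succ N h ih =>
    rw [ih, pow_succ, sum_range_mul_eq]
    refine Finset.sum_congr rfl fun r hr => ?_
    rw [ballInd_eq_sum (Finset.mem_range.mp hr), map_sum, map_sum, Finset.mul_sum]
    refine Finset.sum_congr rfl fun s _ => ?_
    rw [add_smul, mul_comm (p ^ N), mul_smul, depth_le_iff.mp h, smul_zero, add_zero]

/-- Fourier inversion for distributions. -/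
theorem fourierSum_fourierStieltjes (he : Function.Injective e) (μ : Distribution p M)
    {N m : ℕ} (hm : m < p ^ N) : fourierSum e (fourierStieltjes e μ) N m =
      (p : L) ^ N * algebraMap M L (μ (ballInd p M N m)) := by
  simp only [fourierSum, fourierStieltjes_eq μ (depth_frac_le N _), Finset.sum_mul]
  rw [Finset.sum_comm]
  have h : ∀ k ∈ Finset.range (p ^ N), ∑ v ∈ Finset.range (p ^ N),
      e (-(k • frac p N v)) * algebraMap M L (μ (ballInd p M N k)) * e (m • frac p N v) =
      if m = k then (p : L) ^ N * algebraMap M L (μ (ballInd p M N k)) else 0 := by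
    intro k hk
    have h1 := sum_char_frac he hm (Finset.mem_range.mp hk)
    have h2 : ∀ i v : ℕ, i • frac p N v = v • frac p N i := fun i v => by
      rw [smul_frac, smul_frac, mul_comm]
    rw [← ite_zero_mul, ← h1, Finset.sum_mul]
    refine Finset.sum_congr rfl fun v _ => ?_
    rw [h2 k, h2 m]
    ring
  rw [Finset.sum_congr rfl h]
  simp [hm]

theorem fourierStieltjes_injective (he : Function.Injective e) (hp : (p : L) ≠ 0) :
    Function.Injective (fourierStieltjes (M := M) e) := by
  intro μ ν h
  refine Distribution.ext_ballInd fun N k hk => ?_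
  have h1 := fourierSum_fourierStieltjes he μ hk
  rw [h, fourierSum_fourierStieltjes he ν hk] at h1
  exact (algebraMap M L).injective (mul_left_cancel₀ (pow_ne_zero N hp) h1.symm)

/-- A function on the dual group is the transform of a distribution as soon as its Fourier sums
have values in the smaller field. -/
theorem exists_fourierStieltjes_eq (he : Function.Injective e) (hp : (p : L) ≠ 0)
    (φ : PHat p → L) (S : ℕ → ℕ → M)
    (hS : ∀ N m, algebraMap M L (S N m) = fourierSum e φ N m) :
    ∃ μ : Distribution p M, fourierStieltjes e μ = φ := by
  have hpM : (p : M) ≠ 0 := fun h => hp (by simpa using congrArg (algebraMap M L) h)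
  -- Fourier inversion dictates the weights p^{-N} S N k; `sum_fourierSum` is their compatibility.
  obtain ⟨μ, hμ⟩ := exists_distribution (fun N k => ((p : M) ^ N)⁻¹ * S N k) (by
    intro N k _
    apply (algebraMap M L).injective
    simp only [map_sum, map_mul, map_inv₀, map_pow, map_natCast, hS]
    rw [← Finset.mul_sum, sum_fourierSum he]
    field_simp
    ring)
  refine ⟨μ, funext fun t => ?_⟩
  obtain ⟨v, hv, hvt⟩ := exists_eq_frac_depth t
  have h := sum_neg_fourierSum he φ hv
  rw [← hvt] at h
  apply mul_left_cancel₀ (pow_ne_zero (depth t) hp)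
  rw [← h, fourierStieltjes, Finset.mul_sum]
  refine Finset.sum_congr rfl fun k hk => ?_
  rw [hμ _ k (Finset.mem_range.mp hk)]
  simp only [map_mul, map_inv₀, map_pow, map_natCast, hS]
  field_simp

/-- The distributions `X^n(z) dz`. -/
theorem exists_distribution_XHat (he : Function.Injective e) (hp : (p : L) ≠ 0) (a b : Fin p → M) :
    ∃ u c : ℕ → M, u 0 = 1 ∧ c 0 = 0 ∧ ∃ μ : ℕ → Distribution p M,
      (∀ n, fourierStieltjes e (μ n) =
        XHat e (fun k => algebraMap M L (a k)) (fun k => algebraMap M L (b k)) n) ∧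
      ∀ n N m, m < p ^ N → momentSum a b u c n N m = (p : M) ^ N * μ n (ballInd p M N m) := by
  set a' : Fin p → L := fun k => algebraMap M L (a k) with ha'
  set b' : Fin p → L := fun k => algebraMap M L (b k) with hb'
  have hmem := XHat_zero_mem (e := e) (a := a') (b := b') (E := (algebraMap M L).fieldRange)
    (fun k => ⟨a k, rfl⟩) (fun k => ⟨b k, rfl⟩)
  -- Pulling the values at 0 and the defects back to M makes the closed form, hence every Fourier
  -- sum, an element of M.
  choose u hu using fun n => (hmem n).1
  choose c hc using fun n => (hmem n).2
  have hS : ∀ n N m, algebraMap M L (momentSum a b u c n N m) =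
      fourierSum e (XHat e a' b' n) N m := fun n N m => by
    rw [map_momentSum, fourierSum_XHat he hp]
    simp only [hu, hc]
    rfl
  choose μ hμ using fun n => exists_fourierStieltjes_eq (M := M) he hp (XHat e a' b' n)
    (momentSum a b u c n) (hS n)
  refine ⟨u, c, ?_, ?_, μ, hμ, fun n N m hm => ?_⟩
  · apply (algebraMap M L).injective
    rw [hu, XHat_zero_zero, map_one]
  · apply (algebraMap M L).injective
    rw [hc, defect_zero, map_zero]
  · apply (algebraMap M L).injective
    rw [hS, ← hμ, fourierSum_fourierStieltjes he _ hm]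
    simp

end Transform

/-! ### Digit products, digit sums and the solution at integers. -/

section Digits

variable {p : ℕ} [NeZero p] {A : Type*} [CommRing A]

theorem ofNat_mod_pow_succ (m N : ℕ) : Fin.ofNat p (m % p ^ (N + 1)) = Fin.ofNat p m := by
  apply Fin.ext
  exact Nat.mod_mod_of_dvd m (dvd_pow_self p N.succ_ne_zero)

omit [NeZero p] in
theorem mod_pow_succ_div (m N : ℕ) : m % p ^ (N + 1) / p = m / p % p ^ N := by
  rw [pow_succ', Nat.mod_mul_right_div_self]

theorem digitProd_mod (a : Fin p → A) (N m : ℕ) :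
    digitProd a N (m % p ^ N) = digitProd a N m := by
  induction N generalizing m with
  | zero => rfl
  | succ N ih => rw [digitProd, digitProd, ofNat_mod_pow_succ, mod_pow_succ_div, ih]

theorem digitSum_mod (a b : Fin p → A) (N m : ℕ) :
    digitSum a b N (m % p ^ N) = digitSum a b N m := by
  induction N generalizing m with
  | zero => rfl
  | succ N ih => rw [digitSum, digitSum, ofNat_mod_pow_succ, mod_pow_succ_div, ih]

theorem digitProd_res (a : Fin p → A) (z : ZP p) {i N : ℕ} (h : i ≤ N) :
    digitProd a i (z.res N) = digitProd a i (z.res i) := by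
  rw [← digitProd_mod a i (z.res N), z.res_mod_of_le h]

theorem digitSum_res (a b : Fin p → A) (z : ZP p) {i N : ℕ} (h : i ≤ N) :
    digitSum a b i (z.res N) = digitSum a b i (z.res i) := by
  rw [← digitSum_mod a b i (z.res N), z.res_mod_of_le h]

/-- The definition peels off the lowest digit. Splitting off the top one shows the digit sums as
partial sums of a series whose terms are P_N b. -/
theorem digitSum_succ_last (a b : Fin p → A) (N m : ℕ) :
    digitSum a b (N + 1) m = digitSum a b N m + digitProd a N m * b (Fin.ofNat p (m / p ^ N)) := by
  induction N generalizing m with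
  | zero => simp [digitSum, digitProd]
  | succ N ih =>
    rw [digitSum, ih, digitSum, digitProd, Nat.div_div_eq_div_mul, ← pow_succ']
    ring

theorem map_abs_digitProd [Nontrivial A] (v : AbsoluteValue A ℝ) (a : Fin p → A) (N m : ℕ) :
    v (digitProd a N m) = digitProd (fun k => v (a k)) N m := by
  induction N generalizing m with
  | zero => simp [digitProd]
  | succ N ih => simp [digitProd, ih]

/-- The products over the digits in terms of the numbers of occurrences of the digits. -/
theorem digitProd_eq_prod_digitCount (hp : 2 ≤ p) {K : Type*} [Field K] (v : Fin p → K)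
    (hv : v 0 ≠ 0) {N m : ℕ} (hm : m < p ^ N) :
    digitProd v N m = v 0 ^ N * ∏ k ∈ Finset.univ.erase (0 : Fin p),
      (v k / v 0) ^ digitCount p k m := by
  induction N generalizing m with
  | zero =>
    obtain rfl : m = 0 := by simpa using hm
    simp [digitProd, digitCount]
  | succ N ih =>
    have hm' : m / p < p ^ N := by
      rw [Nat.div_lt_iff_lt_mul (by omega), ← pow_succ]; exact hm
    rw [digitProd, ih hm']
    -- For m = 0 all N positions are leading zeros: no digit is counted, and each position
    -- contributes v 0. The power v 0 ^ N accounts for them.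
    rcases Nat.eq_zero_or_pos m with rfl | hpos
    · simp [digitCount]
      ring
    · have h1 : ∀ k : Fin p, digitCount p k m =
          digitCount p k (m / p) + if Fin.ofNat p m = k then 1 else 0 := by
        intro k
        have h2 : m % p = (k : ℕ) ↔ Fin.ofNat p m = k := by
          rw [Fin.ext_iff]; rfl
        simp only [digitCount]
        rw [Nat.digits_def' (by omega) hpos, List.count_cons]
        simp only [beq_iff_eq, h2]
      simp only [h1, pow_add, Finset.prod_mul_distrib]
      have h3 : ∏ k ∈ Finset.univ.erase (0 : Fin p),
          (v k / v 0) ^ (if Fin.ofNat p m = k then 1 else 0) = v (Fin.ofNat p m) / v 0 := by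
        by_cases h0 : Fin.ofNat p m = 0
        · rw [Finset.prod_eq_one, h0, div_self hv]
          intro k hk
          rw [if_neg (by rw [h0]; exact (Finset.ne_of_mem_erase hk).symm), pow_zero]
        · rw [Finset.prod_eq_single_of_mem (Fin.ofNat p m)
            (Finset.mem_erase.mpr ⟨h0, Finset.mem_univ _⟩), if_pos rfl, pow_one]
          intro k _ hk
          rw [if_neg hk.symm, pow_zero]
      rw [h3]
      field_simp

/-- The values at the non-negative integers of the solution of
`X(m) = a_{[m]_p} X(θ_p(m)) + b_{[m]_p}` with `X(0) = x₀`. -/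
def solValue (a b : Fin p → A) (x₀ : A) (m : ℕ) : A :=
  (Nat.digits p m).foldr (fun d x => a (Fin.ofNat p d) * x + b (Fin.ofNat p d)) x₀

theorem solValue_zero (a b : Fin p → A) (x₀ : A) : solValue a b x₀ 0 = x₀ := by simp [solValue]

theorem solValue_eq (hp : 2 ≤ p) {a b : Fin p → A} {x₀ : A} (hx : x₀ = a 0 * x₀ + b 0) (m : ℕ) :
    solValue a b x₀ m =
      a (Fin.ofNat p m) * solValue a b x₀ (m / p) + b (Fin.ofNat p m) := by
  rcases Nat.eq_zero_or_pos m with rfl | hpos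
  · rw [Nat.zero_div, solValue_zero]
    exact hx
  · have h1 : Fin.ofNat p (m % p) = Fin.ofNat p m := Fin.ext (Nat.mod_mod _ _)
    rw [solValue, Nat.digits_def' (by omega) hpos, List.foldr_cons, h1, solValue]

/-- Leading zeros do no harm, since x₀ is fixed by x ↦ a_0 x + b_0; so N may be any length that
accommodates m. -/
theorem solValue_eq_digitProd (hp : 2 ≤ p) {a b : Fin p → A} {x₀ : A} (hx : x₀ = a 0 * x₀ + b 0)
    {N m : ℕ} (hm : m < p ^ N) :
    solValue a b x₀ m = digitProd a N m * x₀ + digitSum a b N m := by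
  induction N generalizing m with
  | zero =>
    obtain rfl : m = 0 := by simpa using hm
    simp [digitProd, digitSum, solValue_zero]
  | succ N ih =>
    have hm' : m / p < p ^ N := by
      rw [Nat.div_lt_iff_lt_mul (by omega), ← pow_succ]; exact hm
    rw [solValue_eq hp hx, ih hm', digitProd, digitSum]
    ring

theorem map_solValue {B : Type*} [CommRing B] (f : A →+* B) (a b : Fin p → A) (x₀ : A) (m : ℕ) :
    f (solValue a b x₀ m) = solValue (fun k => f (a k)) (fun k => f (b k)) (f x₀) m := by
  simp only [solValue]
  induction Nat.digits p m with
  | nil => rfl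
  | cons d l ih => rw [List.foldr_cons, List.foldr_cons, map_add, map_mul, ih]

end Digits

/-! ### Geometric decay and the limit of the Fourier sums. -/

section Decay

theorem exists_geometric_bound {s : ℕ → ℝ} (hs : ∀ n, 0 ≤ s n) {ρ : ℝ} (hρ : ρ < 1)
    (h : Tendsto (fun n : ℕ => s n ^ (1 / (n : ℝ))) atTop (𝓝 ρ)) :
    ∃ C r : ℝ, 0 < r ∧ r < 1 ∧ ∀ n, s n ≤ C * r ^ n := by
  -- The maximum with 0 makes r positive, which allows division by its powers.
  obtain ⟨r, hr1, hr2⟩ := exists_between (max_lt hρ (zero_lt_one' ℝ))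
  have hr0 : 0 < r := (le_max_right _ _).trans_lt hr1
  have h1 : ∀ᶠ n in atTop, s n ≤ r ^ n := by
    filter_upwards [h.eventually (eventually_lt_nhds ((le_max_left _ _).trans_lt hr1)),
      eventually_ge_atTop 1] with n hn hn1
    have hn0 : n ≠ 0 := by omega
    have h2 := pow_le_pow_left₀ (Real.rpow_nonneg (hs n) _) hn.le n
    rwa [one_div, Real.rpow_inv_natCast_pow (hs n) hn0] at h2
  obtain ⟨n₀, hn₀⟩ := eventually_atTop.mp h1
  have h3 : ∀ i, 0 ≤ s i / r ^ i := fun i => div_nonneg (hs i) (pow_nonneg hr0.le i)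
  -- The sum covers the finitely many indices below n₀, the summand 1 all later ones.
  refine ⟨1 + ∑ i ∈ Finset.range n₀, s i / r ^ i, r, hr0, hr2, fun n => ?_⟩
  rw [← div_le_iff₀ (pow_pos hr0 n)]
  by_cases hn : n < n₀
  · have := Finset.single_le_sum (f := fun i => s i / r ^ i) (fun i _ => h3 i)
      (Finset.mem_range.mpr hn)
    linarith
  · have h4 : s n / r ^ n ≤ 1 := (div_le_one (pow_pos hr0 n)).mpr (hn₀ n (by omega))
    have := Finset.sum_nonneg fun i (_ : i ∈ Finset.range n₀) => h3 i
    linarith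

/-- The factor n + 1 will count the N defect terms and the one term in u. -/
theorem tendsto_nat_add_one_mul_of_geometric_bound {s : ℕ → ℝ} (hs : ∀ n, 0 ≤ s n) {C r : ℝ}
    (hr0 : 0 < r) (hr1 : r < 1) (h : ∀ n, s n ≤ C * r ^ n) :
    Tendsto (fun n : ℕ => s n * ((n : ℝ) + 1)) atTop (𝓝 0) := by
  have h1 : Tendsto (fun n : ℕ => C * ((n : ℝ) * r ^ n + r ^ n)) atTop (𝓝 (C * (0 + 0))) :=
    ((tendsto_self_mul_const_pow_of_lt_one hr0.le hr1).add
      (tendsto_pow_atTop_nhds_zero_of_lt_one hr0.le hr1)).const_mul C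
  rw [add_zero, mul_zero] at h1
  refine squeeze_zero (fun n => mul_nonneg (hs n) (by positivity)) (fun n => ?_) h1
  calc s n * ((n : ℝ) + 1) ≤ C * r ^ n * ((n : ℝ) + 1) :=
        mul_le_mul_of_nonneg_right (h n) (by positivity)
    _ = _ := by ring

variable {p : ℕ} [NeZero p] {A : Type*} [CommRing A]

/-- If the products over the digits of `z` decay geometrically, then the Fourier sums of the
transform of `X^n` behave as the powers of the partial sums of the series of `X(z)`. -/
theorem tendsto_momentSum_sub [Nontrivial A] (w : AbsoluteValue A ℝ) (a b : Fin p → A) {u c : ℕ → A}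
    (hu : u 0 = 1) (hc : c 0 = 0) (z : ZP p) {C r B : ℝ} (hr0 : 0 < r) (hr1 : r < 1)
    (hP : ∀ N, w (digitProd a N (z.res N)) ≤ C * r ^ N)
    (hQ : ∀ N, w (digitSum a b N (z.res N)) ≤ B) (n : ℕ) :
    Tendsto (fun N => w (momentSum a b u c n N (z.res N) - digitSum a b N (z.res N) ^ n))
      atTop (𝓝 0) := by
  set D := max B 1 with hD
  have hD1 : 1 ≤ D := le_max_right _ _
  have hQ' : ∀ i j, w (digitSum a b i (z.res i) ^ j) ≤ D ^ j := fun i j => by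
    rw [map_pow]
    exact pow_le_pow_left₀ (w.nonneg _) ((hQ i).trans (le_max_left _ _)) j
  have hP1 := tendsto_nat_add_one_mul_of_geometric_bound (fun N => w.nonneg _) hr0 hr1 hP
  have hP0 : Tendsto (fun N => w (digitProd a N (z.res N))) atTop (𝓝 0) := by
    refine squeeze_zero (fun N => w.nonneg _) (fun N => ?_) hP1
    exact le_mul_of_one_le_right (w.nonneg _) (by simp)
  -- Since u 0 = 1 and c 0 = 0, the terms of degree 0 give exactly Q_N^n. Every remaining term
  -- contains a positive power of P_N.
  have key : ∀ N, momentSum a b u c n N (z.res N) - digitSum a b N (z.res N) ^ n =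
      ∑ k ∈ Finset.range n, (n.choose (k + 1) : A) * digitProd a N (z.res N) ^ (k + 1) *
        (digitSum a b N (z.res N) ^ (n - (k + 1)) * u (k + 1) +
          ∑ i ∈ Finset.range N, digitSum a b i (z.res i) ^ (n - (k + 1)) * c (k + 1)) := by
    intro N
    simp only [momentSum, umbralPow]
    rw [Finset.sum_comm, ← Finset.sum_add_distrib, Finset.sum_range_succ']
    simp only [hu, hc, Nat.choose_zero_right, Nat.cast_one, pow_zero, mul_one, one_mul, mul_zero,
      Finset.sum_const_zero, add_zero, Nat.sub_zero, add_sub_cancel_right]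
    refine Finset.sum_congr rfl fun k _ => ?_
    rw [mul_add, Finset.mul_sum, mul_assoc _ _ (u _)]
    congr 1
    refine Finset.sum_congr rfl fun i hi => ?_
    rw [digitSum_res a b z (Finset.mem_range.mp hi).le, mul_assoc]
  have hbound : ∀ N, w (momentSum a b u c n N (z.res N) - digitSum a b N (z.res N) ^ n) ≤
      ∑ k ∈ Finset.range n, w (n.choose (k + 1) : A) * w (digitProd a N (z.res N)) ^ k *
        (w (digitProd a N (z.res N)) * ((N : ℝ) + 1)) *
          (D ^ (n - (k + 1)) * (w (u (k + 1)) + w (c (k + 1)))) := by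
    intro N
    rw [key]
    refine (w.sum_le _ _).trans (Finset.sum_le_sum fun k _ => ?_)
    rw [map_mul, map_mul, map_pow, pow_succ]
    have h1 : w (digitSum a b N (z.res N) ^ (n - (k + 1)) * u (k + 1) +
        ∑ i ∈ Finset.range N, digitSum a b i (z.res i) ^ (n - (k + 1)) * c (k + 1)) ≤
        ((N : ℝ) + 1) * (D ^ (n - (k + 1)) * (w (u (k + 1)) + w (c (k + 1)))) := by
      refine (w.add_le _ _).trans ?_
      have h2 : w (digitSum a b N (z.res N) ^ (n - (k + 1)) * u (k + 1)) ≤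
          D ^ (n - (k + 1)) * w (u (k + 1)) := by
        rw [map_mul]
        exact mul_le_mul_of_nonneg_right (hQ' _ _) (w.nonneg _)
      have h3 : w (∑ i ∈ Finset.range N, digitSum a b i (z.res i) ^ (n - (k + 1)) * c (k + 1)) ≤
          N * (D ^ (n - (k + 1)) * w (c (k + 1))) := by
        refine (w.sum_le _ _).trans ?_
        refine (Finset.sum_le_card_nsmul _ _ (D ^ (n - (k + 1)) * w (c (k + 1)))
          fun i _ => ?_).trans (by simp)
        rw [map_mul]
        exact mul_le_mul_of_nonneg_right (hQ' _ _) (w.nonneg _)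
      have h4 : 0 ≤ D ^ (n - (k + 1)) := by positivity
      have h5 := mul_nonneg h4 (w.nonneg (u (k + 1)))
      have h6 := mul_nonneg h4 (w.nonneg (c (k + 1)))
      have h7 : (0 : ℝ) ≤ N := Nat.cast_nonneg N
      nlinarith
    refine (mul_le_mul_of_nonneg_left h1 (mul_nonneg (w.nonneg _)
      (mul_nonneg (pow_nonneg (w.nonneg _) _) (w.nonneg _)))).trans_eq ?_
    ring
  refine squeeze_zero (fun N => w.nonneg _) hbound ?_
  rw [← Finset.sum_const_zero (s := Finset.range n)]
  refine tendsto_finsetSum _ fun k _ => ?_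
  have := (((hP0.pow k).const_mul (w (n.choose (k + 1) : A))).mul hP1).mul_const
    (D ^ (n - (k + 1)) * (w (u (k + 1)) + w (c (k + 1))))
  simpa using this

end Decay

/-! ### Completions at an absolute value. -/

section Completion

variable {R S : Type*} [CommRing R] [CommRing S]

theorem toCompl_add (v : AbsoluteValue R ℝ) (r s : R) :
    toCompl v (r + s) = toCompl v r + toCompl v s :=
  UniformSpace.Completion.coe_add _ _

theorem toCompl_sub (v : AbsoluteValue R ℝ) (r s : R) :
    toCompl v (r - s) = toCompl v r - toCompl v s :=
  UniformSpace.Completion.coe_sub _ _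

theorem toCompl_mul (v : AbsoluteValue R ℝ) (r s : R) :
    toCompl v (r * s) = toCompl v r * toCompl v s :=
  UniformSpace.Completion.coe_mul _ _

theorem toCompl_one (v : AbsoluteValue R ℝ) : toCompl v (1 : R) = 1 := rfl

theorem toCompl_pow (v : AbsoluteValue R ℝ) (r : R) (n : ℕ) :
    toCompl v (r ^ n) = toCompl v r ^ n := by
  induction n with
  | zero => simp [toCompl_one]
  | succ n ih => rw [pow_succ, pow_succ, toCompl_mul, ih]

theorem norm_toCompl (v : AbsoluteValue R ℝ) (r : R) : ‖toCompl v r‖ = v r :=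
  UniformSpace.Completion.norm_coe _

theorem toCompl_injective (v : AbsoluteValue R ℝ) : Function.Injective (toCompl v) := by
  intro r s h
  have h1 : v (r - s) = 0 := by
    rw [← norm_toCompl, toCompl_sub, h, sub_self, norm_zero]
  exact sub_eq_zero.mp (v.eq_zero.mp h1)

theorem tendsto_toCompl_zero (v : AbsoluteValue R ℝ) {f : ℕ → R}
    (h : Tendsto (fun n => v (f n)) atTop (𝓝 0)) :
    Tendsto (fun n => toCompl v (f n)) atTop (𝓝 0) := by
  rw [tendsto_zero_iff_norm_tendsto_zero]
  simpa only [norm_toCompl] using h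

variable {v : AbsoluteValue R ℝ} {w : AbsoluteValue S ℝ} {f : R →+* S}

theorem continuous_complMap : Continuous (complMap v w f) :=
  UniformSpace.Completion.continuous_map

theorem complMap_toCompl (h : ∀ r, w (f r) = v r) (r : R) :
    complMap v w f (toCompl v r) = toCompl w (f r) := by
  have h1 : Isometry (WithAbs.map v w f) :=
    AddMonoidHomClass.isometry_of_norm _ fun x => h x.ofAbs
  exact UniformSpace.Completion.map_coe h1.uniformContinuous _

end Completion

/-! ### The solution X and the Fourier transforms of its powers. -/

namespace Frame

variable {p : ℕ} [NeZero p] {R : Type*} [CommRing R] {F : Frame p R}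

/-- Geometric decay of the products over the digits at the points of the domain. -/
def HasDecay (F : Frame p R) (a : Fin p → R) : Prop :=
  ∀ z : F.dom, ∃ C r : ℝ, 0 < r ∧ r < 1 ∧
    ∀ N, F.abs z (digitProd a N (z.1.res N)) ≤ C * r ^ N

theorem HasDecay.tendsto_zero {a : Fin p → R} (ha : F.HasDecay a) (z : F.dom) :
    Tendsto (fun N => F.abs z (digitProd a N (z.1.res N))) atTop (𝓝 0) := by
  obtain ⟨C, r, hr0, hr1, h⟩ := ha z
  have h1 := (tendsto_pow_atTop_nhds_zero_of_lt_one hr0.le hr1).const_mul C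
  rw [mul_zero] at h1
  exact squeeze_zero (fun N => (F.abs z).nonneg _) h h1

/-- Consecutive digit sums differ by P_N times some b_k, which is geometrically small. -/
theorem HasDecay.exists_tendsto {a : Fin p → R} (ha : F.HasDecay a) (b : Fin p → R) (z : F.dom) :
    ∃ x, Tendsto (fun N => toCompl (F.abs z) (digitSum a b N (z.1.res N))) atTop (𝓝 x) := by
  obtain ⟨C, r, hr0, hr1, h⟩ := ha z
  apply cauchySeq_tendsto_of_complete
  obtain ⟨B, hB⟩ : ∃ B, ∀ k, F.abs z (b k) ≤ B :=
    ⟨∑ k, F.abs z (b k), fun k => Finset.single_le_sum (f := fun k => F.abs z (b k))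
      (fun i _ => (F.abs z).nonneg _) (Finset.mem_univ k)⟩
  have hB0 : 0 ≤ B := ((F.abs z).nonneg _).trans (hB 0)
  refine cauchySeq_of_le_geometric r (C * B) hr1 fun N => ?_
  rw [dist_comm, dist_eq_norm, ← toCompl_sub, norm_toCompl, digitSum_succ_last,
    digitProd_res a z.1 N.le_succ, digitSum_res a b z.1 N.le_succ, add_sub_cancel_left, map_mul]
  calc _ ≤ C * r ^ N * B := mul_le_mul (h N) (hB _) ((F.abs z).nonneg _)
        (((F.abs z).nonneg _).trans (h N))
    _ = _ := by ring

/-- The rising-continuous solution of the functional equation. -/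
theorem HasDecay.exists_solution (hp : 2 ≤ p) (hF : F.Reffinite) {a b : Fin p → R}
    (ha : F.HasDecay a) {x₀ : R} (hx : x₀ = a 0 * x₀ + b 0) :
    ∃ X : F.Compat, F.RisingContinuous X ∧ F.FunctionalEquation hF a b X ∧
      ∀ z : F.dom, Tendsto (fun N => toCompl (F.abs z) (digitSum a b N (z.1.res N))) atTop
        (𝓝 (X z)) := by
  choose X hX using ha.exists_tendsto b
  -- The solution at [z]_{p^N} is P_N x₀ + Q_N, so it has the same limit as Q_N.
  have hlim : ∀ z : F.dom, Tendsto
      (fun N => toCompl (F.abs z) (solValue a b x₀ (z.1.res N))) atTop (𝓝 (X z)) := by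
    intro z
    have h1 : Tendsto (fun N => toCompl (F.abs z) (digitProd a N (z.1.res N) * x₀)) atTop
        (𝓝 0) := by
      apply tendsto_toCompl_zero
      simp only [map_mul]
      simpa using (ha.tendsto_zero z).mul_const (F.abs z x₀)
    have h2 := h1.add (hX z)
    rw [zero_add] at h2
    refine h2.congr fun N => ?_
    rw [← toCompl_add, solValue_eq_digitProd hp hx (z.1.res_lt N)]
  refine ⟨X, ⟨solValue a b x₀, fun m hm => ?_, hlim⟩, fun z => ?_, hX⟩
  · refine tendsto_nhds_unique (hlim ⟨_, hm⟩) (tendsto_const_nhds.congr' ?_)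
    filter_upwards [eventually_ge_atTop m] with N hN
    have : m < p ^ N := (Nat.lt_pow_self (by omega)).trans_le
      (Nat.pow_le_pow_right (by omega) hN)
    exact congrArg (fun k => toCompl _ (solValue a b x₀ k)) (Nat.mod_eq_of_lt this).symm
  · have h1 := (hlim z).comp (tendsto_add_atTop_nat 1)
    refine tendsto_nhds_unique h1 ?_
    have h2 := (((continuous_complMap (v := F.abs ⟨z.1.shift, hF.shift_mem z.1 z.2⟩)
      (w := F.abs z) (f := RingHom.id R)).tendsto _).comp
        (hlim ⟨z.1.shift, hF.shift_mem z.1 z.2⟩)).const_mul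
        (toCompl (F.abs z) (a z.1.digit))
    refine (h2.add_const (toCompl (F.abs z) (b z.1.digit))).congr fun N => ?_
    have h3 : Fin.ofNat p (z.1.res (N + 1)) = z.1.digit := by
      apply Fin.ext
      have := z.1.res_mod_of_le (show 1 ≤ N + 1 by omega)
      rwa [pow_one] at this
    rw [Function.comp_apply, Function.comp_apply, complMap_toCompl, ← toCompl_mul, ← toCompl_add,
      solValue_eq hp hx (z.1.res (N + 1)), h3]
    · rfl
    · intro r
      rw [hF.abs_shift z]
      rfl

theorem shift_ofNat (m : ℕ) : (ZP.ofNat p m).shift = ZP.ofNat p (m / p) := by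
  ext n
  exact mod_pow_succ_div m n

/-- Uniqueness of the rising-continuous solution. -/
theorem solution_unique (hp : 2 ≤ p) (hF : F.Reffinite) {a b : Fin p → R}
    (ha : IsUnit (1 - a 0)) {X Y : F.Compat} (hX : F.RisingContinuous X)
    (hY : F.RisingContinuous Y) (hX' : F.FunctionalEquation hF a b X)
    (hY' : F.FunctionalEquation hF a b Y) : Y = X := by
  -- The ring embeds in each completion, so at integers the equation is a recursion in the ring
  -- itself.
  have key : ∀ (Z : F.Compat), F.FunctionalEquation hF a b Z → ∀ f : ℕ → R,
      (∀ (m : ℕ) (hm : ZP.ofNat p m ∈ F.dom), Z ⟨ZP.ofNat p m, hm⟩ = toCompl _ (f m)) →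
      ∀ m, f m = a (Fin.ofNat p m) * f (m / p) + b (Fin.ofNat p m) := by
    intro Z hZ f hf m
    have h1 := hZ ⟨ZP.ofNat p m, hF.ofNat_mem m⟩
    have h3 : ∀ (y : ZP p) (hy : y ∈ F.dom), y = ZP.ofNat p (m / p) →
        Z ⟨y, hy⟩ = toCompl _ (f (m / p)) := by
      rintro y hy rfl
      exact hf _ _
    have h4 : (ZP.ofNat p m).digit = Fin.ofNat p m := by
      apply Fin.ext
      simp [ZP.digit, ZP.ofNat]
    rw [hf, h3 _ _ (shift_ofNat m), complMap_toCompl, ← toCompl_mul, ← toCompl_add] at h1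
    · have h5 := toCompl_injective _ h1
      simp only [h4] at h5
      exact h5
    · intro r
      rw [hF.abs_shift ⟨ZP.ofNat p m, hF.ofNat_mem m⟩]
      rfl
  obtain ⟨f, hf, hf'⟩ := hX
  obtain ⟨g, hg, hg'⟩ := hY
  have h1 := key X hX' f hf
  have h2 := key Y hY' g hg
  have hfg : ∀ m, g m = f m := by
    intro m
    induction m using Nat.strong_induction_on with
    | _ m ih =>
      rcases Nat.eq_zero_or_pos m with rfl | hpos
      -- At 0 the recursion reads (1 - a_0) f(0) = b_0, and 1 - a_0 is a unit.
      · have h3 := h1 0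
        have h4 := h2 0
        rw [Nat.zero_div] at h3 h4
        have h5 : Fin.ofNat p 0 = 0 := rfl
        rw [h5] at h3 h4
        apply ha.mul_left_cancel
        linear_combination h4 - h3
      · rw [h1, h2, ih _ (Nat.div_lt_self hpos (by omega))]
  funext z
  refine tendsto_nhds_unique (hg' z) ((hf' z).congr fun n => ?_)
  rw [hfg]

/-- The transforms `XHat n` are Fourier transforms of the powers of the solution. -/
theorem HasDecay.isFourierTransform {a b : Fin p → R} (ha : F.HasDecay a) {L : Type*} [Field L]
    {ι : R →+* L} {e : AddChar (PHat p) L} (he : Function.Injective e) (hpL : (p : L) ≠ 0)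
    {X : F.Compat} (hX : ∀ z : F.dom, Tendsto
      (fun N => toCompl (F.abs z) (digitSum a b N (z.1.res N))) atTop (𝓝 (X z))) (n : ℕ) :
    F.IsFourierTransform ι e (X ^ n) (XHat e (fun k => ι (a k)) (fun k => ι (b k)) n) := by
  intro z w hw
  set a' : Fin p → L := fun k => ι (a k) with ha'
  set b' : Fin p → L := fun k => ι (b k) with hb'
  obtain ⟨C, r, hr0, hr1, h⟩ := ha z
  obtain ⟨B, hB⟩ := (hX z).norm.bddAbove_range
  -- As w extends the absolute value at z, the bounds on P_N and Q_N hold in L as well.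
  have h1 := tendsto_toCompl_zero w (tendsto_momentSum_sub w a' b'
    (u := fun k => XHat e a' b' k 0) (c := defect e a' b') (XHat_zero_zero a' b')
    (defect_zero a' b') z.1 hr0 hr1 (C := C) (B := B)
    (fun N => by rw [ha', ← map_digitProd, hw]; exact h N)
    (fun N => by
      rw [ha', hb', ← map_digitSum, hw, ← norm_toCompl]; exact hB ⟨N, rfl⟩) n)
  have h2 : Tendsto (fun N => complMap (F.abs z) w ι
      (toCompl (F.abs z) (digitSum a b N (z.1.res N)) ^ n)) atTop
      (𝓝 (complMap (F.abs z) w ι ((X ^ n) z))) :=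
    (continuous_complMap.tendsto _).comp ((hX z).pow n)
  have h3 := h1.add h2
  rw [zero_add] at h3
  refine h3.congr fun N => ?_
  rw [← toCompl_pow, complMap_toCompl hw, ← toCompl_add, map_pow, map_digitSum,
    sub_add_cancel, ← fourierSum_XHat he hpL]
  congr 1
  refine Finset.sum_congr rfl fun k _ => ?_
  -- A frequency of level N does not distinguish [z]_{p^N} from the residue at its own depth.
  rw [charEval, ← z.1.res_mod_of_le (depth_frac_le N k),
    char_smul_mod e _ _ (pow_depth_smul _)]

end Frame

/-! ### Transport of the polynomial product to a span. -/

section FreeAlgebra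

variable {K V W : Type*} [Field K] [AddCommGroup V] [Module K V] [AddCommGroup W] [Module K W]

theorem exists_equiv_span {v : ℕ → V} (hv : LinearIndependent K v) :
    ∃ Φ : K[X] ≃ₗ[K] Submodule.span K (Set.range v), ∀ n : ℕ, (Φ (X ^ n) : V) = v n := by
  refine ⟨(Polynomial.basisMonomials K).equiv (Module.Basis.span hv) (Equiv.refl ℕ), fun n => ?_⟩
  have h : (X ^ n : K[X]) = Polynomial.basisMonomials K n := by
    rw [Polynomial.coe_basisMonomials, X_pow_eq_monomial]
  rw [h, Module.Basis.equiv_apply, Equiv.refl_apply, Module.Basis.span_apply]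

/-- The product on a span that corresponds to the product of polynomials. -/
def polyProduct {S : Type*} [AddCommGroup S] [Module K S] (Φ : K[X] ≃ₗ[K] S) : S →ₗ[K] S →ₗ[K] S :=
  ((LinearMap.mul K K[X]).compl₁₂ Φ.symm.toLinearMap Φ.symm.toLinearMap).compr₂ Φ.toLinearMap

theorem polyProduct_apply {S : Type*} [AddCommGroup S] [Module K S] (Φ : K[X] ≃ₗ[K] S)
    (f g : K[X]) : polyProduct Φ (Φ f) (Φ g) = Φ (f * g) := by
  simp [polyProduct]

theorem isPowerProduct_polyProduct {v : ℕ → V} {Φ : K[X] ≃ₗ[K] Submodule.span K (Set.range v)}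
    (hΦ : ∀ n : ℕ, (Φ (X ^ n) : V) = v n) : IsPowerProduct (K := K) v (polyProduct Φ) := by
  intro m n
  have h : ∀ k, (⟨v k, Submodule.subset_span ⟨k, rfl⟩⟩ : Submodule.span K (Set.range v)) =
      Φ (X ^ k) := fun k => Subtype.ext (hΦ k).symm
  rw [h, h, polyProduct_apply, ← pow_add, hΦ]

theorem generatesFreeAlgebra_of_linearIndependent {v : ℕ → V} (hv : LinearIndependent K v) :
    GeneratesFreeAlgebra K v := by
  obtain ⟨Φ, hΦ⟩ := exists_equiv_span hv
  have h : ∀ k, (⟨v k, Submodule.subset_span ⟨k, rfl⟩⟩ : Submodule.span K (Set.range v)) =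
      Φ (X ^ k) := fun k => Subtype.ext (hΦ k).symm
  refine ⟨polyProduct Φ, ⟨isPowerProduct_polyProduct hΦ, Φ, hΦ,
    fun f g => (polyProduct_apply Φ f g).symm⟩, ?_⟩
  rintro mul ⟨hmul, -⟩
  -- A bilinear map on K[x] is determined by pairs of monomials, where the power rule fixes it.
  have key : mul.compl₁₂ Φ.toLinearMap Φ.toLinearMap =
      (LinearMap.mul K K[X]).compr₂ Φ.toLinearMap := by
    refine Polynomial.lhom_ext' fun m => LinearMap.ext_ring ?_
    refine Polynomial.lhom_ext' fun n => LinearMap.ext_ring ?_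
    simp only [LinearMap.comp_apply, LinearMap.compl₁₂_apply, LinearMap.compr₂_apply,
      LinearEquiv.coe_coe, LinearMap.mul_apply', ← X_pow_eq_monomial]
    apply Subtype.ext
    rw [← h, ← h, hmul m n, ← pow_add, hΦ]
  refine LinearMap.ext fun x => LinearMap.ext fun y => ?_
  have h1 := LinearMap.congr_fun (LinearMap.congr_fun key (Φ.symm x)) (Φ.symm y)
  simpa [polyProduct] using h1

theorem inducesAlgebraIso_of_linearIndependent (T : V →ₗ[K] W) {v : ℕ → V} {w : ℕ → W}
    (hv : LinearIndependent K v) (hw : LinearIndependent K w) (hT : ∀ n, T (v n) = w n) :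
    InducesAlgebraIso K T v w := by
  obtain ⟨Φ, hΦ⟩ := exists_equiv_span hv
  obtain ⟨Θ, hΘ⟩ := exists_equiv_span hw
  refine ⟨polyProduct Φ, polyProduct Θ, isPowerProduct_polyProduct hΦ,
    isPowerProduct_polyProduct hΘ, Φ.symm.trans Θ, fun x => ?_, fun x y => ?_⟩
  · obtain ⟨f, rfl⟩ := Φ.surjective x
    rw [LinearEquiv.trans_apply, Φ.symm_apply_apply]
    have key : (Submodule.subtype _).comp Θ.toLinearMap =
        T.comp ((Submodule.subtype _).comp Φ.toLinearMap) := by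
      refine Polynomial.lhom_ext' fun n => LinearMap.ext_ring ?_
      simp only [LinearMap.comp_apply, LinearEquiv.coe_coe, Submodule.subtype_apply,
        ← X_pow_eq_monomial, hΦ, hΘ, hT]
    exact LinearMap.congr_fun key f
  · obtain ⟨f, rfl⟩ := Φ.surjective x
    obtain ⟨g, rfl⟩ := Φ.surjective y
    simp only [polyProduct_apply, LinearEquiv.trans_apply, Φ.symm_apply_apply]

theorem linearIndependent_of_sum_eq_zero {v : ℕ → V}
    (h : ∀ f : K[X], (f.sum fun n c => c • v n) = 0 → f = 0) : LinearIndependent K v := by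
  rw [linearIndependent_iff']
  intro s g hg i hi
  have h1 : (∑ j ∈ s, monomial j (g j) : K[X]) = 0 := by
    apply h
    have h2 : ∀ f : K[X], Polynomial.lsum (fun n => LinearMap.toSpanSingleton K V (v n)) f =
        f.sum fun n c => c • v n := fun f => by simp [Polynomial.lsum_apply]
    rw [← h2, ← hg, map_sum]
    refine Finset.sum_congr rfl fun j _ => ?_
    rw [h2, Polynomial.sum_monomial_index _ _ (zero_smul K _)]
  have h2 := congrArg (fun f : K[X] => f.coeff i) h1
  simpa [Polynomial.finsetSum_coeff, coeff_monomial, hi] using h2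

end FreeAlgebra

/-! ### Extension of absolute values to fraction fields. -/

section FractionField

variable {A M : Type*} [CommRing A] [IsDomain A] [Field M] [Algebra A M] [IsFractionRing A M]

/-- An absolute value extends to the field of fractions. -/
theorem exists_absoluteValue_extension (v : AbsoluteValue A ℝ) :
    ∃ w : AbsoluteValue M ℝ, ∀ r, w (algebraMap A M r) = v r := by
  have hinj := IsFractionRing.injective A M
  have hdiv : ∀ x : M, ∃ r s : A, s ≠ 0 ∧ x = algebraMap A M r / algebraMap A M s := fun x => by
    obtain ⟨r, s, hs, hx⟩ := IsFractionRing.div_surjective (A := A) x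
    exact ⟨r, s, nonZeroDivisors.ne_zero hs, hx.symm⟩
  choose num den hden hx using hdiv
  have hne : ∀ {s : A}, s ≠ 0 → algebraMap A M s ≠ 0 := fun hs => by
    rwa [Ne, map_eq_zero_iff _ hinj]
  -- The quotient v r / v s depends only on the fraction, so the chosen representatives may be
  -- replaced by convenient ones.
  have key : ∀ (x : M) (r s : A), s ≠ 0 → x = algebraMap A M r / algebraMap A M s →
      v (num x) / v (den x) = v r / v s := by
    intro x r s hs hxr
    have h1 : num x * s = r * den x := by
      apply hinj
      have h2 := hxr.symm.trans (hx x)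
      rw [div_eq_div_iff (hne hs) (hne (hden x))] at h2
      rw [map_mul, map_mul, h2]
    rw [div_eq_div_iff (v.ne_zero (hden x)) (v.ne_zero hs), ← map_mul, ← map_mul, h1]
  refine ⟨⟨⟨fun x => v (num x) / v (den x), fun x y => ?_⟩, fun x => ?_, fun x => ?_,
    fun x y => ?_⟩, fun r => ?_⟩
  · rw [key (x * y) (num x * num y) (den x * den y) (mul_ne_zero (hden x) (hden y)), map_mul,
      map_mul, mul_div_mul_comm]
    conv_lhs => rw [hx x, hx y]
    rw [map_mul, map_mul, div_mul_div_comm]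
  · exact div_nonneg (v.nonneg _) (v.nonneg _)
  · change v (num x) / v (den x) = 0 ↔ x = 0
    rw [div_eq_zero_iff, or_iff_left (v.ne_zero (hden x)), v.eq_zero]
    conv_rhs => rw [hx x, div_eq_zero_iff, or_iff_left (hne (hden x)), map_eq_zero_iff _ hinj]
  · change v (num (x + y)) / v (den (x + y)) ≤ v (num x) / v (den x) + v (num y) / v (den y)
    rw [key (x + y) (num x * den y + den x * num y) (den x * den y)
      (mul_ne_zero (hden x) (hden y)), div_add_div _ _ (v.ne_zero (hden x))
      (v.ne_zero (hden y)), map_mul]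
    · refine div_le_div_of_nonneg_right ?_ (mul_nonneg (v.nonneg _) (v.nonneg _))
      simpa only [map_mul] using v.add_le (num x * den y) (den x * num y)
    · conv_lhs => rw [hx x, hx y]
      rw [div_add_div _ _ (hne (hden x)) (hne (hden y))]
      simp only [map_mul, map_add]
  · change v (num _) / v (den _) = v r
    rw [key (algebraMap A M r) r 1 one_ne_zero (by simp)]
    simp

end FractionField

/-! ### From linear relations between distributions to algebraic relations between values. -/

section Independence

theorem toCompl_sum {R ι : Type*} [CommRing R] (v : AbsoluteValue R ℝ) (s : Finset ι)
    (f : ι → R) : toCompl v (∑ i ∈ s, f i) = ∑ i ∈ s, toCompl v (f i) := by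
  classical
  induction s using Finset.induction_on with
  | empty => exact UniformSpace.Completion.coe_zero
  | insert i s hi ih => rw [Finset.sum_insert hi, Finset.sum_insert hi, toCompl_add, ih]

variable {p : ℕ} [NeZero p] {A : Type*} [CommRing A] {G : Frame p A} {M : Type*} [Field M]
  [Algebra A M]

/-- A linear relation between the distributions is an algebraic relation for the values at the
non-negative integers. -/
theorem aeval_eq_zero_of_sum_eq_zero [IsDomain A] [IsFractionRing A M] (hp : 2 ≤ p)
    (hG : G.Reffinite) {a b : Fin p → A}
    (ha : G.HasDecay a) {x₀ : A} (hx : x₀ = a 0 * x₀ + b 0) {u c : ℕ → M} (hu : u 0 = 1)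
    (hc : c 0 = 0) {μ : ℕ → Distribution p M}
    (hμ : ∀ n N m, m < p ^ N → momentSum (fun k => algebraMap A M (a k))
      (fun k => algebraMap A M (b k)) u c n N m = (p : M) ^ N * μ n (ballInd p M N m))
    {K : Type*} [Field K] [Algebra K M] {f : K[X]} (hf : (f.sum fun n c => c • μ n) = 0) (m : ℕ) :
    aeval (algebraMap A M (solValue a b x₀ m)) f = 0 := by
  let z : G.dom := ⟨ZP.ofNat p m, hG.ofNat_mem m⟩
  -- The coefficients u, c and those of f lie only in M, so the limit is taken in a completion of M.
  obtain ⟨w, hw⟩ := exists_absoluteValue_extension (M := M) (G.abs z)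
  obtain ⟨C, r, hr0, hr1, h⟩ := ha z
  set x := algebraMap A M (solValue a b x₀ m) with hxdef
  set a' : Fin p → M := fun k => algebraMap A M (a k) with ha'
  set b' : Fin p → M := fun k => algebraMap A M (b k) with hb'
  have hres : ∀ᶠ N in atTop, z.1.res N = m := by
    filter_upwards [eventually_ge_atTop m] with N hN
    exact Nat.mod_eq_of_lt ((Nat.lt_pow_self (by omega)).trans_le
      (Nat.pow_le_pow_right (by omega) hN))
  have hQ : Tendsto (fun N => toCompl w (digitSum a' b' N (z.1.res N))) atTop
      (𝓝 (toCompl w x)) := by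
    have h1 : Tendsto (fun N => toCompl w
        (-(algebraMap A M (digitProd a N (z.1.res N) * x₀)))) atTop (𝓝 0) := by
      apply tendsto_toCompl_zero
      simp only [map_neg_eq_map, hw, map_mul]
      simpa using (ha.tendsto_zero z).mul_const (G.abs z x₀)
    have h2 := h1.const_add (toCompl w x)
    rw [add_zero] at h2
    refine h2.congr' ?_
    filter_upwards [hres] with N hN
    have h3 := solValue_eq_digitProd hp hx (z.1.res_lt N)
    have h4 : x = algebraMap A M (solValue a b x₀ (z.1.res N)) := by rw [hN]
    rw [← toCompl_add, h4, h3, map_add, map_digitSum]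
    congr 1
    ring
  obtain ⟨B, hB⟩ := hQ.norm.bddAbove_range
  have hmom : ∀ n, Tendsto (fun N => toCompl w (momentSum a' b' u c n N (z.1.res N))) atTop
      (𝓝 (toCompl w x ^ n)) := by
    intro n
    have h1 := tendsto_toCompl_zero w (tendsto_momentSum_sub w a' b' hu hc z.1 hr0 hr1
      (C := C) (B := B) (fun N => by rw [ha', ← map_digitProd, hw]; exact h N)
      (fun N => by rw [← norm_toCompl]; exact hB ⟨N, rfl⟩) n)
    have h2 := h1.add (hQ.pow n)
    rw [zero_add] at h2
    refine h2.congr fun N => ?_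
    rw [← toCompl_pow, ← toCompl_add, sub_add_cancel]
  -- The relation is tested on the ball of level N about m; the factor p^N turns measures of balls
  -- into Fourier sums.
  have hzero : ∀ N, ∑ n ∈ f.support,
      algebraMap K M (f.coeff n) * momentSum a' b' u c n N (z.1.res N) = 0 := by
    intro N
    have h1 := LinearMap.congr_fun hf (ballInd p M N (z.1.res N))
    rw [Polynomial.sum_def, LinearMap.sum_apply, LinearMap.zero_apply] at h1
    rw [← mul_zero ((p : M) ^ N), ← h1, Finset.mul_sum]
    refine Finset.sum_congr rfl fun n _ => ?_
    rw [hμ n N _ (z.1.res_lt N), LinearMap.smul_apply, Algebra.smul_def]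
    ring
  have hlim := tendsto_finsetSum f.support fun n _ =>
    (hmom n).const_mul (toCompl w (algebraMap K M (f.coeff n)))
  apply toCompl_injective w
  have h0 : toCompl w 0 = 0 := UniformSpace.Completion.coe_zero
  rw [aeval_def, eval₂_eq_sum, Polynomial.sum_def, toCompl_sum, h0]
  simp only [toCompl_mul, toCompl_pow]
  refine tendsto_nhds_unique hlim (tendsto_const_nhds.congr fun N => ?_)
  simp only [← toCompl_mul, ← toCompl_sum, hzero, h0]

theorem eq_zero_of_infinite_range {K : Type*} [Field K] [Algebra K M] {x : ℕ → M}
    (hx : (Set.range x).Infinite) {f : K[X]} (hf : ∀ m, aeval (x m) f = 0) : f = 0 := by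
  rw [← Polynomial.map_eq_zero (algebraMap K M)]
  refine Polynomial.eq_zero_of_infinite_isRoot _ (hx.mono ?_)
  rintro _ ⟨m, rfl⟩
  rw [Set.mem_ofPred_eq, IsRoot.def, eval_map_algebraMap, hf]

/-- If `a_0 ≠ 0`, then a solution that is not constant takes infinitely many values. -/
theorem infinite_range_solValue [IsDomain A] (hp : 2 ≤ p) (hG : G.Reffinite) {a b : Fin p → A}
    (ha : G.HasDecay a) {x₀ : A} (hx : x₀ = a 0 * x₀ + b 0) (ha0 : a 0 ≠ 0)
    {m : ℕ} (hm : solValue a b x₀ m ≠ solValue a b x₀ 0) :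
    (Set.range (solValue a b x₀)).Infinite := by
  let z : G.dom := ⟨ZP.ofNat p 0, hG.ofNat_mem 0⟩
  have h1 : ∀ N, digitProd a N 0 = a 0 ^ N := fun N => by
    induction N with
    | zero => simp [digitProd]
    | succ N ih => rw [digitProd, Nat.zero_div, ih, pow_succ']; rfl
  -- All digits of 0 vanish, so decay at z = 0 says that a_0^N tends to 0.
  have hlt : G.abs z (a 0) < 1 := by
    by_contra! hge
    have h2 := ha.tendsto_zero z
    have h3 : ∀ N, 1 ≤ G.abs z (digitProd a N (z.1.res N)) := fun N => by
      have : z.1.res N = 0 := Nat.zero_mod _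
      rw [this, h1, map_pow]
      exact one_le_pow₀ hge
    have := ge_of_tendsto' h2 h3
    linarith
  -- Inserting k lowest digits 0 contracts the difference from the fixed point x₀ by a_0^k; these
  -- differences are distinct as 0 < |a_0| < 1.
  have h4 : ∀ k, solValue a b x₀ (p ^ k * m) - x₀ = a 0 ^ k * (solValue a b x₀ m - x₀) := by
    intro k
    induction k with
    | zero => simp
    | succ k ih =>
      have h5 : Fin.ofNat p (p ^ (k + 1) * m) = 0 := by
        apply Fin.ext
        change p ^ (k + 1) * m % p = 0 % p
        rw [pow_succ', mul_assoc, Nat.mul_mod_right, Nat.zero_mod]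
      have h6 : p ^ (k + 1) * m / p = p ^ k * m := by
        rw [pow_succ', mul_assoc, Nat.mul_div_cancel_left _ (NeZero.pos p)]
      rw [solValue_eq hp hx, h5, h6, pow_succ', mul_assoc, ← ih]
      linear_combination -hx
  rw [solValue_zero, ← sub_ne_zero] at hm
  refine (Set.infinite_range_of_injective (f := fun k : ℕ => solValue a b x₀ (p ^ k * m))
    fun k l hkl => ?_).mono (by rintro _ ⟨k, rfl⟩; exact ⟨_, rfl⟩)
  simp only at hkl
  have h7 : a 0 ^ k = a 0 ^ l := by
    apply mul_right_cancel₀ hm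
    rw [← h4, ← h4, hkl]
  have h8 := congrArg (G.abs z) h7
  rw [map_pow, map_pow] at h8
  exact (pow_right_strictAnti₀ ((G.abs z).pos ha0) hlt).injective h8

end Independence

/-! ### Linearity of the transform over K. -/

section Linear

variable {p : ℕ} {K M L : Type*} [Field K] [Field M] [Field L] [Algebra M L]
  [Algebra K M] [Algebra K L] [IsScalarTower K M L]

variable (K) in
/-- The Fourier–Stieltjes transform as a linear map. -/
def fourierStieltjesLinear (e : AddChar (PHat p) L) : Distribution p M →ₗ[K] (PHat p → L) where
  toFun := fourierStieltjes e
  map_add' μ ν := by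
    funext t
    simp only [fourierStieltjes, LinearMap.add_apply, map_add, mul_add, Finset.sum_add_distrib,
      Pi.add_apply]
  map_smul' c μ := by
    funext t
    simp only [fourierStieltjes, LinearMap.smul_apply, Algebra.smul_def c (_ : M), map_mul,
      ← IsScalarTower.algebraMap_apply, Pi.smul_apply, RingHom.id_apply,
      Algebra.smul_def c (_ : L), Finset.mul_sum]
    exact Finset.sum_congr rfl fun k _ => by ring

end Linear

/-! ### The rings ℛ and ℛ/Iℛ, and decay from the root test. -/

section Rings

variable {p : ℕ} [NeZero p] {O : Type*} [CommRing O]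

theorem isDomain_of_isGlobalFieldIntegers {K : Type*} [Field K] [Algebra O K]
    (hK : IsGlobalFieldIntegers O K) : IsDomain O := by
  rcases hK with ⟨-, h⟩ | ⟨ℓ, _, _, _, _, -, h⟩
  · exact (IsIntegralClosure.algebraMap_injective O ℤ K).isDomain (algebraMap O K)
  · exact (IsIntegralClosure.algebraMap_injective O (ZMod ℓ)[X] K).isDomain (algebraMap O K)

/-- Sending x to 1/(1 - a_0) maps ℛ to the fraction field of R, where a_0 survives. This makes the
divisions by |a_0| in the root test genuine. -/
theorem toLoc_indA_ne_zero [IsDomain O] : toLoc p O (indA O 0) ≠ 0 := by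
  let Q := FractionRing (PolyRing p O)
  have hinj := IsFractionRing.injective (PolyRing p O) Q
  have h1 : (1 - indA O (0 : Fin p)) ≠ 0 := by
    intro h
    have := congrArg (MvPolynomial.eval (fun _ => (0 : O))) h
    simp [indA] at this
  have h2 : algebraMap (PolyRing p O) Q (1 - indA O 0) ≠ 0 := by
    rwa [Ne, map_eq_zero_iff _ hinj]
  let f : LocRing p O →+* Q := AdjoinRoot.lift (algebraMap (PolyRing p O) Q)
    (algebraMap (PolyRing p O) Q (1 - indA O 0))⁻¹ (by
      rw [eval₂_sub, eval₂_mul, eval₂_C, eval₂_X, eval₂_one, mul_inv_cancel₀ h2, sub_self])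
  intro h
  have h3 := congrArg f h
  simp only [f, toLoc, AdjoinRoot.lift_of, map_zero] at h3
  rw [map_eq_zero_iff _ hinj] at h3
  exact MvPolynomial.X_ne_zero _ h3

theorem isUnit_one_sub_quotA (I : Ideal (PolyRing p O)) : IsUnit (1 - quotA I 0) := by
  have h : toLoc p O (1 - indA O 0) * AdjoinRoot.root _ = 1 := by
    have := AdjoinRoot.eval₂_root (C (1 - indA O (0 : Fin p)) * X - 1 : (PolyRing p O)[X])
    rw [eval₂_sub, eval₂_mul, eval₂_C, eval₂_X, eval₂_one] at this
    exact sub_eq_zero.mp this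
  have h1 : IsUnit (toLoc p O (1 - indA O 0)) := IsUnit.of_mul_eq_one _ h
  have h2 := h1.map (Ideal.Quotient.mk (locIdeal I))
  have h3 : Ideal.Quotient.mk (locIdeal I) (toLoc p O (1 - indA O 0)) = 1 - quotA I 0 := by
    change toQuot I (1 - indA O 0) = 1 - toQuot I (indA O 0)
    rw [map_sub, map_one]
  rwa [h3] at h2

omit [NeZero p] in
theorem Frame.quotient_abs_mk_le {R : Type*} [CommRing R] (F : Frame p R) (I : Ideal R)
    (h : ∀ z : F.dom, IsAbsoluteValue (F.quotSeminorm I z)) (z : F.dom) (r : R) :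
    (F.quotient I h).abs z (Ideal.Quotient.mk I r) ≤ F.abs z r := by
  change F.quotSeminorm I z (Ideal.Quotient.mk I r) ≤ _
  refine ciInf_le (f := fun s : {s : R // Ideal.Quotient.mk I s = Ideal.Quotient.mk I r} =>
    F.abs z s.1) ⟨0, ?_⟩ ⟨r, rfl⟩
  rintro _ ⟨s, rfl⟩
  exact (F.abs z).nonneg _

/-- The expression in the root test is |P_N|^{1/N} on ℛ, and the quotient seminorm can only be
smaller. -/
theorem RootTest.hasDecay [IsDomain O] (hp : 2 ≤ p) {F : Frame p (LocRing p O)}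
    (hF : RootTest F) (I : Ideal (PolyRing p O))
    (h : ∀ z : F.dom, IsAbsoluteValue (F.quotSeminorm (locIdeal I) z)) :
    (F.quotient (locIdeal I) h).HasDecay (quotA I) := by
  intro z
  have : Nontrivial (LocRing p O) := ⟨_, 0, toLoc_indA_ne_zero (p := p) (O := O)⟩
  obtain ⟨ρ, hρ, hlim⟩ := hF z
  have h0 : F.abs z (toLoc p O (indA O 0)) ≠ 0 := (F.abs z).ne_zero toLoc_indA_ne_zero
  have h1 : ∀ n, F.abs z (digitProd (fun k => toLoc p O (indA O k)) n (z.1.res n)) =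
      F.abs z (toLoc p O (indA O 0)) ^ n *
        ∏ k ∈ Finset.univ.erase (0 : Fin p),
          (F.abs z (toLoc p O (indA O k)) / F.abs z (toLoc p O (indA O 0))) ^
            digitCount p k (z.1.res n) := fun n => by
    rw [map_abs_digitProd, digitProd_eq_prod_digitCount hp _ h0 (z.1.res_lt n)]
  simp only [← h1] at hlim
  obtain ⟨C, r, hr0, hr1, hC⟩ := exists_geometric_bound (fun n => (F.abs z).nonneg _) hρ hlim
  refine ⟨C, r, hr0, hr1, fun N => ?_⟩
  refine le_trans ?_ (hC N)
  refine le_of_eq_of_le ?_ (F.quotient_abs_mk_le (locIdeal I) h z _)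
  rw [map_digitProd]
  rfl

end Rings

end FSeries

end

/-! ### The main theorem. -/

theorem mainTheorem2
    (p : ℕ) [NeZero p] (hp : 2 ≤ p)
    -- a global field `K` with ring of integers `O`
    (K O : Type*) [Field K] [CommRing O] [Algebra O K] (hK : FSeries.IsGlobalFieldIntegers O K)
    (hchar : ringChar K = 0 ∨ (ringChar K).Coprime p)
    -- a unique-solution ideal `I`, with `p` non-zero in `ℛ / Iℛ`
    (I : Ideal (FSeries.PolyRing p O)) (hI : FSeries.UniqueSolutionIdeal I)
    (hpI : (p : FSeries.QuotRing I) ≠ 0)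
    -- a reffinite frame on `ℛ`, with a quotient frame on `ℛ / Iℛ`
    (F : FSeries.Frame p (FSeries.LocRing p O)) (hF : F.Reffinite)
    (hdom : F.dom ⊆ FSeries.NiceDig p) (hroot : FSeries.RootTest F)
    (hquot : ∀ z : F.dom, IsAbsoluteValue (F.quotSeminorm (FSeries.locIdeal I) z))
    -- the fraction field `M` of `ℛ / Iℛ`, the field `L = M(ζ_{p^∞})`, and `e(t) = e^{2πit}`
    (M L : Type*) [Field M] [Algebra (FSeries.QuotRing I) M]
    [IsFractionRing (FSeries.QuotRing I) M]
    [Field L] [Algebra M L] [IsCyclotomicExtension (Set.range fun k : ℕ => p ^ k) M L]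
    (e : AddChar (FSeries.PHat p) L) (he : Function.Injective e) :
    let G := F.quotient (FSeries.locIdeal I) hquot
    let ι : FSeries.QuotRing I →+* L :=
      (algebraMap M L).comp (algebraMap (FSeries.QuotRing I) M)
    let XHat : ℕ → FSeries.PHat p → L :=
      FSeries.XHat e (fun k => ι (FSeries.quotA I k)) (fun k => ι (FSeries.quotB I k))
    ∃ X : G.Compat,
      -- existence and uniqueness of the rising-continuous solution
      (G.RisingContinuous X ∧
        G.FunctionalEquation (hF.quotient _ hquot) (FSeries.quotA I) (FSeries.quotB I) X) ∧
      (∀ Y : G.Compat, G.RisingContinuous Y →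
        G.FunctionalEquation (hF.quotient _ hquot) (FSeries.quotA I) (FSeries.quotB I) Y →
        Y = X) ∧
      -- the powers are quasi-integrable, with the stated Fourier transforms
      (∀ n : ℕ, G.QuasiIntegrable ι e (X ^ n)) ∧
      (∀ n : ℕ, G.IsFourierTransform ι e (X ^ n) (XHat n)) ∧
      -- the distributions `X^n(z) dz` and the algebra which they generate
      ∃ μ : ℕ → FSeries.Distribution p M,
        (∀ n : ℕ, FSeries.fourierStieltjes e (μ n) = XHat n) ∧
        (∀ (n : ℕ) (ν : FSeries.Distribution p M),
          FSeries.fourierStieltjes e ν = XHat n → ν = μ n) ∧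
        ∀ [Algebra K M] [Algebra K L] [IsScalarTower K M L],
          (∀ c : O, algebraMap K M (algebraMap O K c) =
            algebraMap (FSeries.QuotRing I) M (FSeries.toQuot I (MvPolynomial.C c))) →
          let x : ℕ → M := FSeries.natValue
            (fun k => algebraMap (FSeries.QuotRing I) M (FSeries.quotA I k))
            (fun k => algebraMap (FSeries.QuotRing I) M (FSeries.quotB I k))
          ((FSeries.quotA I 0 ≠ 0 ∧ ∃ m : ℕ, x m ≠ x 0) ∨ (Set.range x).Infinite ∨
            ∃ m : ℕ, Transcendental K (x m)) →
          FSeries.GeneratesFreeAlgebra K μ ∧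
            FSeries.InducesAlgebraIso K (FSeries.fourierStieltjes e) μ XHat := by
  intro G ι XHat
  have hO := FSeries.isDomain_of_isGlobalFieldIntegers hK
  have hinj := IsFractionRing.injective (FSeries.QuotRing I) M
  have hdomQ : IsDomain (FSeries.QuotRing I) := hinj.isDomain (algebraMap _ M)
  have hpL : (p : L) ≠ 0 := by
    have h : ι p ≠ 0 := by
      rwa [Ne, map_eq_zero_iff ι ((algebraMap M L).injective.comp hinj)]
    rwa [map_natCast] at h
  have hdecay : G.HasDecay (FSeries.quotA I) := hroot.hasDecay hp I hquot
  have hunit := FSeries.isUnit_one_sub_quotA I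
  obtain ⟨y, hy⟩ := hunit.exists_right_inv
  -- The fixed point is b_0/(1 - a_0), with y the inverse of 1 - a_0.
  obtain ⟨x₀, hx⟩ : ∃ x₀, x₀ = FSeries.quotA I 0 * x₀ + FSeries.quotB I 0 :=
    ⟨y * FSeries.quotB I 0, by linear_combination FSeries.quotB I 0 * hy⟩
  have hG : G.Reffinite := hF.quotient _ hquot
  obtain ⟨X, hX1, hX2, hX3⟩ := hdecay.exists_solution hp hG hx
  have hFT := fun n => hdecay.isFourierTransform (ι := ι) he hpL hX3 n
  obtain ⟨u, c, hu, hc, μ, hμ1, hμ2⟩ := FSeries.exists_distribution_XHat he hpL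
    (fun k => algebraMap (FSeries.QuotRing I) M (FSeries.quotA I k))
    (fun k => algebraMap (FSeries.QuotRing I) M (FSeries.quotB I k))
  refine ⟨X, ⟨hX1, hX2⟩, fun Y hY1 hY2 => FSeries.Frame.solution_unique hp hG hunit hX1 hY1 hX2 hY2,
    fun n => ⟨_, hFT n⟩, hFT, μ, hμ1, fun n ν hν => ?_, ?_⟩
  · exact FSeries.fourierStieltjes_injective he hpL (hν.trans (hμ1 n).symm)
  intro _ _ _ _ x hcases
  have hxval : ∀ m, x m = algebraMap (FSeries.QuotRing I) M
      (FSeries.solValue (FSeries.quotA I) (FSeries.quotB I) x₀ m) := by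
    intro m
    have h1 : (1 : M) - algebraMap (FSeries.QuotRing I) M (FSeries.quotA I 0) ≠ 0 := by
      rw [← map_one (algebraMap (FSeries.QuotRing I) M), ← map_sub, Ne, map_eq_zero_iff _ hinj]
      exact hunit.ne_zero
    have h2 : algebraMap (FSeries.QuotRing I) M (FSeries.quotB I 0) /
        (1 - algebraMap (FSeries.QuotRing I) M (FSeries.quotA I 0)) =
        algebraMap (FSeries.QuotRing I) M x₀ := by
      have h3 := congrArg (algebraMap (FSeries.QuotRing I) M) hx
      rw [map_add, map_mul] at h3
      rw [div_eq_iff h1]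
      linear_combination -h3
    rw [FSeries.map_solValue, ← h2]
    rfl
  have hzero : ∀ f : K[X], (f.sum fun n c => c • μ n) = 0 → f = 0 := by
    intro f hf
    have h1 : ∀ m, aeval (x m) f = 0 := fun m => by
      rw [hxval]
      exact FSeries.aeval_eq_zero_of_sum_eq_zero hp hG hdecay hx hu hc hμ2 hf m
    rcases hcases with ⟨ha0, m, hm⟩ | hinf | ⟨m, hm⟩
    · refine FSeries.eq_zero_of_infinite_range (x := x) ?_ h1
      have h2 := FSeries.infinite_range_solValue hp hG hdecay hx ha0 (m := m)
        (fun h => hm (by rw [hxval, hxval, h]))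
      have h3 : Set.range x = algebraMap (FSeries.QuotRing I) M ''
          Set.range (FSeries.solValue (FSeries.quotA I) (FSeries.quotB I) x₀) := by
        rw [← Set.range_comp]
        exact congrArg Set.range (funext hxval)
      rw [h3]
      exact h2.image hinj.injOn
    · exact FSeries.eq_zero_of_infinite_range hinf h1
    · exact transcendental_iff.mp hm f (h1 m)
  have hli := FSeries.linearIndependent_of_sum_eq_zero hzero
  refine ⟨FSeries.generatesFreeAlgebra_of_linearIndependent hli,
    FSeries.inducesAlgebraIso_of_linearIndependent (FSeries.fourierStieltjesLinear K e) hli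
      ?_ hμ1⟩
  -- Injectivity of the transform makes the functions X̂^{*n} linearly independent too, so their
  -- span also carries the product of K[x].
  have h4 := hli.map' (FSeries.fourierStieltjesLinear K e)
    (LinearMap.ker_eq_bot.mpr (FSeries.fourierStieltjes_injective he hpL))
  have h5 : (FSeries.fourierStieltjesLinear K e) ∘ μ = XHat := funext hμ1
  rwa [h5] at h4
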